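/- Let $\mathcal H\subset\mathbb R$ be an open set with $(-a_0,a_0)\subset\mathcal H\subset(-a,a)$ for some $0<a_0<a<\infty$. Let $J\in C^2_c(\mathbb R)$ satisfy $J\ge 0$, $\int_{\mathbb R}J=1$, $J(x)=J(-x)$ for all $x$, $J(x_1)\ge J(x_2)$ whenever $0\le x_1\le x_2$, and $\{J>0\}=(-d,d)$; put $Lg:=J*g-g$. Let $u_0\in L^\infty(\mathbb R)$ satisfy $u_0\ge0$, $u_0=0$ in $\mathcal H$ and $\int_{\mathbb R}u_0(x)(1+x^2)\,dx<\infty$. Let $u\in C\big([0,\infty);L^1(\mathbb R,(1+x^2)\,dx)\big)$ be the solution of $$ \begin{cases} \partial_t u(x,t)=Lu(x,t) & \text{in }(\mathbb R\setminus\mathcal H)\times(0,\infty),\\ u(x,t)=0 & \text{in }\mathcal H\times(0,\infty),\\ u(x,0)=u_0(x) & \text{in }\mathbb R. \end{cases} $$ Then there exist constants $b>0$, $\alpha>0$, $T>0$ and $C>0$ such that, for every $t>T$ and almost every $x\in\mathbb R\setminus\mathcal H$ with $(|x|+b)^2\le 4\alpha t$, $$ u(x,t)\le C\,\frac{|x|+b}{t^{3/2}}\,e^{-\frac{(|x|+b)^2}{4\alpha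 t}} . $$ -/

import Mathlib

open MeasureTheory Set

/-- Hypothesis on the hole `H`: an open set with `(-a₀, a₀) ⊆ H ⊆ (-a, a)`, `0 < a₀ < a < ∞`.
It need not be connected. -/
structure IsHole (H : Set ℝ) (a₀ a : ℝ) : Prop where
  isOpen : IsOpen H
  a₀_pos : 0 < a₀
  a₀_lt : a₀ < a
  inner_subset : Ioo (-a₀) a₀ ⊆ H
  subset_outer : H ⊆ Ioo (-a) a

/-- Hypothesis on the kernel `J`: a nonnegative, even function of class `C²`, of unit mass,
nonincreasing on `[0, ∞)`, and positive exactly on `(-d, d)` (hence compactly supported, and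
`0 < d`). -/
structure IsKernel (J : ℝ → ℝ) (d : ℝ) : Prop where
  contDiff : ContDiff ℝ 2 J
  nonneg : ∀ x, 0 ≤ J x
  support_eq : Function.support J = Ioo (-d) d
  integral_eq_one : ∫ x, J x = 1
  even : ∀ x, J (-x) = J x
  antitoneOn : AntitoneOn J (Ici 0)

/-- Hypothesis on the initial datum: nonnegative, bounded, zero in the hole, with finite
mass and second moment (all of them almost everywhere notions). -/
structure IsInitialDatum (H : Set ℝ) (u₀ : ℝ → ℝ) : Prop where
  nonneg : ∀ᵐ x, 0 ≤ u₀ x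
  memLp_top : MemLp u₀ ⊤ volume
  eq_zero : ∀ᵐ x, x ∈ H → u₀ x = 0
  integrable : Integrable (fun x => u₀ x * (1 + x ^ 2)) volume

/-- The measure `(1 + x²) dx` on the line. -/
noncomputable def weightedMeasure : Measure ℝ :=
  volume.withDensity (fun x => ENNReal.ofReal (1 + x ^ 2))

/-- The space `L¹(ℝ, (1 + x²) dx)`. -/
abbrev WeightedL1 : Type := Lp ℝ 1 weightedMeasure

/-- The nonlocal operator `L g = J * g - g`. -/
noncomputable def nonlocalOp (J g : ℝ → ℝ) (x : ℝ) : ℝ :=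
  convolution J g (ContinuousLinearMap.lsmul ℝ ℝ) volume x - g x

/-- `u ∈ C([0, ∞); L¹(ℝ, (1 + x²) dx))` solves `∂ₜu = Lu` in `(ℝ ∖ H) × (0, ∞)`, with `u = 0` in
`H × (0, ∞)` and `u(·, 0) = u₀`. The values of `u` at negative times play no role; `∂ₜu` is the
derivative of the curve `t ↦ u(·, t)` in `L¹(ℝ, (1 + x²) dx)`. -/
structure IsSolution (H : Set ℝ) (J u₀ : ℝ → ℝ) (u : ℝ → WeightedL1) : Prop where
  continuousOn : ContinuousOn u (Ici 0)
  equation : ∀ t > 0, ∃ v : WeightedL1, HasDerivAt u v t ∧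
    ∀ᵐ x, x ∉ H → v x = nonlocalOp J (u t) x
  eq_zero : ∀ t > 0, ∀ᵐ x, x ∈ H → u t x = 0
  initial : ∀ᵐ x, u 0 x = u₀ x

open scoped FourierTransform ENNReal

/-! Where `(|x| + b)² ≤ 4αt` the Gaussian factor is at least `e⁻¹`, so everything reduces to a bound
`|u| ≤ C (|x| + b) t^(-3/2)` off the hole, and any `α` will do. Let `S` be convolution with `J`
followed by restriction to `Hᶜ`: one step of a random walk killed in `H`. The solution is `e⁻ᵗ ∑
tⁿ/n! Sⁿ u₀` (`IsSolution.hasSum`), so it suffices to bound `Sⁿ` by `(|x| + b) n^(-3/2)`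
(`IsKernel.killedOp_iterate_le`) and average over a Poisson law (`sum_pow_div_factorial_mul_le`).
The exponent `3/2` is three factors `n^(-1/2)`, each from about a third of the steps. First, the
mass decays, with constant the moment of the datum against `|x| + b`; then `L¹` is smoothed to `L^∞`
by the local limit bound for the free walk (`IsKernel.convPow_le`); finally the survival probability
from `x` is at most `C (|x| + b) n^(-1/2)`, which is the mass bound read through the symmetry of
`S`. Mass decay rests on `|x| + b` being superharmonic for the killed walk
(`IsKernel.killedOp_abs_le`), so that its moment never grows. Splitting at radius `R` gives mass `≤
2R sup + R⁻¹ moment`; with smoothing for the supremum and `R` of order `√n`, this closes by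
induction. -/

/-! ### Basic properties of the kernel and bounds for its Fourier transform. -/

theorem IsKernel.continuous {J : ℝ → ℝ} {d : ℝ} (hJ : IsKernel J d) : Continuous J :=
  hJ.contDiff.continuous

theorem IsKernel.hasCompactSupport {J : ℝ → ℝ} {d : ℝ} (hJ : IsKernel J d) :
    HasCompactSupport J := by
  refine HasCompactSupport.intro (isCompact_Icc (a := -d) (b := d)) fun x hx => ?_
  by_contra h
  have : x ∈ Ioo (-d) d := by rw [← hJ.support_eq]; exact h
  exact hx (Ioo_subset_Icc_self this)

theorem IsKernel.integrable {J : ℝ → ℝ} {d : ℝ} (hJ : IsKernel J d) : Integrable J :=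
  hJ.continuous.integrable_of_hasCompactSupport hJ.hasCompactSupport

theorem IsKernel.eq_zero_of_le_abs {J : ℝ → ℝ} {d : ℝ} (hJ : IsKernel J d) {x : ℝ}
    (hx : d ≤ |x|) : J x = 0 := by
  by_contra h
  have : x ∈ Ioo (-d) d := by rw [← hJ.support_eq]; exact h
  exact absurd (abs_lt.2 this) (not_lt.2 hx)

theorem IsKernel.pos_of_abs_lt {J : ℝ → ℝ} {d : ℝ} (hJ : IsKernel J d) {x : ℝ}
    (hx : |x| < d) : 0 < J x := by
  have : x ∈ Function.support J := by rw [hJ.support_eq]; exact abs_lt.1 hx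
  exact lt_of_le_of_ne (hJ.nonneg x) (Ne.symm this)

theorem IsKernel.radius_pos {J : ℝ → ℝ} {d : ℝ} (hJ : IsKernel J d) : 0 < d := by
  by_contra! h
  have : J = 0 := by
    ext x
    exact hJ.eq_zero_of_le_abs (h.trans (abs_nonneg x))
  have h1 := hJ.integral_eq_one
  simp [this] at h1

theorem IsKernel.integrable_mul {J : ℝ → ℝ} {d : ℝ} (hJ : IsKernel J d) {g : ℝ → ℝ}
    (hg : Continuous g) : Integrable (fun x => J x * g x) :=
  (hJ.continuous.mul hg).integrable_of_hasCompactSupport hJ.hasCompactSupport.mul_right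

theorem IsKernel.integral_mul_pos {J : ℝ → ℝ} {d : ℝ} (hJ : IsKernel J d) {g : ℝ → ℝ}
    (hg : Continuous g) (hg0 : ∀ x, 0 ≤ g x) {x₀ : ℝ} (hx₀ : |x₀| < d) (hgx : g x₀ ≠ 0) :
    0 < ∫ x, J x * g x := by
  refine integral_pos_of_integrable_nonneg_nonzero (x := x₀) (hJ.continuous.mul hg)
    (hJ.integrable_mul hg) (fun x => mul_nonneg (hJ.nonneg x) (hg0 x)) ?_
  exact mul_ne_zero (hJ.pos_of_abs_lt hx₀).ne' hgx

/-- The Fourier transform of an even real kernel is its cosine transform. -/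
theorem IsKernel.fourier_eq {J : ℝ → ℝ} {d : ℝ} (hJ : IsKernel J d) (ξ : ℝ) :
    𝓕 (fun x => (J x : ℂ)) ξ = ((∫ x, J x * Real.cos (2 * Real.pi * ξ * x) : ℝ) : ℂ) := by
  have hc : Integrable (fun x => J x * Real.cos (2 * Real.pi * ξ * x)) :=
    hJ.integrable_mul (by fun_prop)
  have hs : Integrable (fun x => J x * Real.sin (2 * Real.pi * ξ * x)) :=
    hJ.integrable_mul (by fun_prop)
  have hs0 : ∫ x, J x * Real.sin (2 * Real.pi * ξ * x) = 0 := by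
    have h := integral_neg_eq_self (fun x => J x * Real.sin (2 * Real.pi * ξ * x)) volume
    have h2 : (fun x => J (-x) * Real.sin (2 * Real.pi * ξ * (-x)))
        = fun x => -(J x * Real.sin (2 * Real.pi * ξ * x)) := by
      ext x; rw [hJ.even]; simp
    rw [h2, integral_neg] at h
    linarith
  rw [Real.fourier_real_eq_integral_exp_smul]
  have h3 : (fun v : ℝ => Complex.exp (↑(-2 * Real.pi * v * ξ) * Complex.I) • (J v : ℂ))
      = fun v => ((J v * Real.cos (2 * Real.pi * ξ * v) : ℝ) : ℂ)
        - ((J v * Real.sin (2 * Real.pi * ξ * v) : ℝ) : ℂ) * Complex.I := by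
    ext v
    rw [Complex.exp_mul_I, ← Complex.ofReal_cos, ← Complex.ofReal_sin]
    have : -2 * Real.pi * v * ξ = -(2 * Real.pi * ξ * v) := by ring
    rw [this, Real.cos_neg, Real.sin_neg]
    push_cast
    simp only [smul_eq_mul]
    ring
  rw [h3, integral_sub hc.ofReal (hs.ofReal.mul_const _), integral_mul_const,
    integral_complex_ofReal, integral_complex_ofReal, hs0]
  simp

theorem IsKernel.norm_fourier_eq {J : ℝ → ℝ} {d : ℝ} (hJ : IsKernel J d) (ξ : ℝ) :
    ‖𝓕 (fun x => (J x : ℂ)) ξ‖ = |∫ x, J x * Real.cos (2 * Real.pi * ξ * x)| := by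
  rw [hJ.fourier_eq, Complex.norm_real, Real.norm_eq_abs]

theorem IsKernel.norm_fourier_lt_one {J : ℝ → ℝ} {d : ℝ} (hJ : IsKernel J d) {ξ : ℝ}
    (hξ : ξ ≠ 0) : ‖𝓕 (fun x => (J x : ℂ)) ξ‖ < 1 := by
  have hd := hJ.radius_pos
  have hc : Integrable (fun x => J x * Real.cos (2 * Real.pi * ξ * x)) :=
    hJ.integrable_mul (by fun_prop)
  have hξ' : 0 < |ξ| := abs_pos.2 hξ
  -- at this point the cosine is neither `1` nor `-1`
  set x₀ : ℝ := min (d / 2) (1 / (4 * |ξ|)) with hx₀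
  have hx₀pos : 0 < x₀ := lt_min (by positivity) (by positivity)
  have hx₀d : |x₀| < d := by
    rw [abs_of_pos hx₀pos]
    exact (min_le_left _ _).trans_lt (by linarith)
  have hθ : 2 * Real.pi * |ξ| * x₀ ≤ Real.pi / 2 := by
    have : x₀ ≤ 1 / (4 * |ξ|) := min_le_right _ _
    calc 2 * Real.pi * |ξ| * x₀ ≤ 2 * Real.pi * |ξ| * (1 / (4 * |ξ|)) := by gcongr
      _ = Real.pi / 2 := by field_simp; ring
  have hθ0 : 0 < 2 * Real.pi * |ξ| * x₀ := by positivity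
  have hcos : Real.cos (2 * Real.pi * ξ * x₀) = Real.cos (2 * Real.pi * |ξ| * x₀) := by
    rw [← Real.cos_abs (2 * Real.pi * ξ * x₀)]
    congr 1
    rw [abs_mul, abs_mul, abs_of_pos hx₀pos, abs_of_pos (by positivity : (0:ℝ) < 2 * Real.pi)]
  have hc0 : 0 ≤ Real.cos (2 * Real.pi * |ξ| * x₀) :=
    Real.cos_nonneg_of_mem_Icc ⟨by linarith, hθ⟩
  have hc1 : Real.cos (2 * Real.pi * |ξ| * x₀) < 1 := by
    have := Real.cos_lt_cos_of_nonneg_of_le_pi_div_two le_rfl hθ hθ0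
    rwa [Real.cos_zero] at this
  rw [hJ.norm_fourier_eq, abs_lt]
  have h1 : 0 < ∫ x, J x * (1 + Real.cos (2 * Real.pi * ξ * x)) :=
    hJ.integral_mul_pos (by fun_prop) (fun x => by linarith [Real.neg_one_le_cos (2 * Real.pi * ξ * x)])
      hx₀d (by rw [hcos]; linarith)
  have h2 : 0 < ∫ x, J x * (1 - Real.cos (2 * Real.pi * ξ * x)) :=
    hJ.integral_mul_pos (by fun_prop) (fun x => by linarith [Real.cos_le_one (2 * Real.pi * ξ * x)])
      hx₀d (by rw [hcos]; linarith)
  simp only [mul_add, mul_sub, mul_one] at h1 h2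
  rw [integral_add hJ.integrable hc, hJ.integral_eq_one] at h1
  rw [integral_sub hJ.integrable hc, hJ.integral_eq_one] at h2
  constructor <;> linarith

/-- Quadratic behaviour of the Fourier transform of the kernel at low frequencies. -/
theorem IsKernel.norm_fourier_low {J : ℝ → ℝ} {d : ℝ} (hJ : IsKernel J d) :
    ∃ m > 0, ∀ ξ, |ξ| ≤ 1 / (4 * d) → ‖𝓕 (fun x => (J x : ℂ)) ξ‖ ≤ 1 - m * ξ ^ 2 := by
  have hd := hJ.radius_pos
  -- The 8 is `(2/π²)(2π)²`, from `cos θ ≤ 1 - (2/π²) θ²` at `θ = 2πξx`. For `|ξ| ≤ 1/(4d)` one has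
  -- `|θ| ≤ π/2` on the support of `J`, so the transform is also nonnegative and the absolute value
  -- disappears.
  refine ⟨8 * ∫ x, J x * x ^ 2, ?_, fun ξ hξ => ?_⟩
  · have := hJ.integral_mul_pos (g := fun x => x ^ 2) (by fun_prop) (fun x => sq_nonneg x)
      (x₀ := d / 2) (by rw [abs_of_pos (by positivity)]; linarith) (by positivity)
    positivity
  have hc : Integrable (fun x => J x * Real.cos (2 * Real.pi * ξ * x)) :=
    hJ.integrable_mul (by fun_prop)
  have hθ : ∀ x, |x| < d → |2 * Real.pi * ξ * x| ≤ Real.pi / 2 := fun x hx => by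
    rw [abs_mul, abs_mul, abs_of_pos (by positivity : (0:ℝ) < 2 * Real.pi)]
    calc 2 * Real.pi * |ξ| * |x| ≤ 2 * Real.pi * (1 / (4 * d)) * d := by gcongr
      _ = Real.pi / 2 := by field_simp; ring
  rw [hJ.norm_fourier_eq, abs_of_nonneg]
  · have : 1 - (8 * ∫ x, J x * x ^ 2) * ξ ^ 2 = ∫ x, J x * (1 - 8 * ξ ^ 2 * x ^ 2) := by
      have e : ∀ x, J x * (1 - 8 * ξ ^ 2 * x ^ 2) = J x - 8 * ξ ^ 2 * (J x * x ^ 2) :=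
        fun x => by ring
      simp only [e]
      rw [integral_sub hJ.integrable ((hJ.integrable_mul (by fun_prop)).const_mul _),
        integral_const_mul, hJ.integral_eq_one]
      ring
    rw [this]
    refine integral_mono hc (hJ.integrable_mul (by fun_prop)) fun x => ?_
    rcases lt_or_ge |x| d with hx | hx
    · refine mul_le_mul_of_nonneg_left ?_ (hJ.nonneg x)
      have := Real.cos_le_one_sub_mul_cos_sq
        ((hθ x hx).trans (by linarith [Real.pi_pos]))
      have e : 2 / Real.pi ^ 2 * (2 * Real.pi * ξ * x) ^ 2 = 8 * ξ ^ 2 * x ^ 2 := by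
        field_simp; ring
      linarith
    · simp [hJ.eq_zero_of_le_abs hx]
  · refine integral_nonneg fun x => ?_
    rcases lt_or_ge |x| d with hx | hx
    · exact mul_nonneg (hJ.nonneg x) (Real.cos_nonneg_of_mem_Icc (abs_le.1 (hθ x hx)))
    · simp [hJ.eq_zero_of_le_abs hx]

/-- Quadratic decay of the Fourier transform of the kernel at high frequencies. -/
theorem IsKernel.norm_fourier_high {J : ℝ → ℝ} {d : ℝ} (hJ : IsKernel J d) :
    ∃ C > 0, ∀ ξ, ξ ^ 2 * ‖𝓕 (fun x => (J x : ℂ)) ξ‖ ≤ C := by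
  have hcd : ContDiff ℝ 2 (fun x => (J x : ℂ)) := Complex.ofRealCLM.contDiff.comp hJ.contDiff
  have hcs : HasCompactSupport (fun x => (J x : ℂ)) :=
    hJ.hasCompactSupport.comp_left (g := fun r : ℝ => (r : ℂ)) (by simp)
  have hint : ∀ n : ℕ, (n : ℕ∞) ≤ 2 → Integrable (iteratedDeriv n (fun x => (J x : ℂ))) := by
    intro n hn
    refine Continuous.integrable_of_hasCompactSupport ?_ ?_
    · exact hcd.continuous_iteratedDeriv n (by exact_mod_cast hn)
    · clear hn
      induction n with
      | zero => simpa using hcs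
      | succ n ih => rw [iteratedDeriv_succ]; exact ih.deriv
  have h := Real.fourier_iteratedDeriv (N := 2) (n := 2) (by exact_mod_cast hcd) hint le_rfl
  set D := iteratedDeriv 2 (fun x => (J x : ℂ))
  -- The transform of `J''` is `(2πiξ)²` times that of `J` and is bounded by the `L¹` norm of `J''`;
  -- the `+ 1` only makes the constant positive.
  refine ⟨(∫ x, ‖D x‖) + 1, by positivity, fun ξ => ?_⟩
  have h1 : ‖𝓕 D ξ‖ ≤ ∫ x, ‖D x‖ := by
    exact VectorFourier.norm_fourierIntegral_le_integral_norm Real.fourierChar volume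
      (innerₗ ℝ) D ξ
  rw [h] at h1
  rw [norm_smul, norm_pow] at h1
  have h2 : ‖(2 * Real.pi * Complex.I * ξ : ℂ)‖ = 2 * Real.pi * |ξ| := by
    simp [abs_of_pos Real.pi_pos]
  rw [h2, mul_pow, sq_abs] at h1
  have h3 : (1:ℝ) ≤ (2 * Real.pi) ^ 2 := by nlinarith [Real.pi_gt_three]
  have h4 : 0 ≤ ξ ^ 2 * ‖𝓕 (fun x => (J x : ℂ)) ξ‖ := by positivity
  nlinarith

theorem IsKernel.continuous_fourier {J : ℝ → ℝ} {d : ℝ} (hJ : IsKernel J d) :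
    Continuous (𝓕 (fun x => (J x : ℂ))) :=
  VectorFourier.fourierIntegral_continuous Real.continuous_fourierChar
    (by exact continuous_inner) hJ.integrable.ofReal

/-- Glues the low and high frequency bounds, with compactness and the strict bound by 1 in between.
The form `(1 + cξ²)⁻¹` is chosen because, by Bernoulli's inequality, its powers stay below an
integrable function of the same form with `c` multiplied by the exponent. -/
theorem IsKernel.norm_fourier_le {J : ℝ → ℝ} {d : ℝ} (hJ : IsKernel J d) :
    ∃ c > 0, ∀ ξ, ‖𝓕 (fun x => (J x : ℂ)) ξ‖ ≤ (1 + c * ξ ^ 2)⁻¹ := by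
  obtain ⟨m, hm, hlow⟩ := hJ.norm_fourier_low
  obtain ⟨C, hC, hhigh⟩ := hJ.norm_fourier_high
  have hd := hJ.radius_pos
  set q : ℝ → ℝ := fun ξ => ‖𝓕 (fun x => (J x : ℂ)) ξ‖ with hq
  have hqc : Continuous q := hJ.continuous_fourier.norm
  have hq0 : ∀ ξ, 0 ≤ q ξ := fun ξ => norm_nonneg _
  set r := 1 / (4 * d) with hr
  have hr0 : 0 < r := by positivity
  obtain ⟨R, hR0, hR⟩ : ∃ R > 0, 2 * C ≤ R ^ 2 :=
    ⟨2 * C + 1, by positivity, by nlinarith⟩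
  obtain ⟨δ, hδ, hmid⟩ : ∃ δ > 0, ∀ ξ, r ≤ |ξ| → |ξ| ≤ R → q ξ * (1 + δ) ≤ 1 := by
    have hK : IsCompact (Icc (-R) R ∩ {ξ | r ≤ |ξ|}) :=
      isCompact_Icc.inter_right (isClosed_le continuous_const continuous_abs)
    rcases (Icc (-R) R ∩ {ξ : ℝ | r ≤ |ξ|}).eq_empty_or_nonempty with he | hne
    · refine ⟨1, one_pos, fun ξ h1 h2 => ?_⟩
      have : ξ ∈ Icc (-R) R ∩ {ξ : ℝ | r ≤ |ξ|} := ⟨abs_le.1 h2, h1⟩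
      rw [he] at this
      exact this.elim
    · obtain ⟨ξ₀, hξ₀, hmax⟩ := hK.exists_isMaxOn hne hqc.continuousOn
      have h0 : ξ₀ ≠ 0 := abs_pos.1 (hr0.trans_le hξ₀.2)
      have h1 : q ξ₀ < 1 := hJ.norm_fourier_lt_one h0
      refine ⟨1 - q ξ₀, by linarith, fun ξ h2 h3 => ?_⟩
      have h4 : q ξ ≤ q ξ₀ := hmax (⟨abs_le.1 h3, h2⟩ : ξ ∈ Icc (-R) R ∩ {ξ : ℝ | r ≤ |ξ|})
      nlinarith [hq0 ξ, sq_nonneg (1 - q ξ₀)]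
  refine ⟨min m (min (δ / R ^ 2) (1 / (2 * C))), by positivity, fun ξ => ?_⟩
  set c := min m (min (δ / R ^ 2) (1 / (2 * C)))
  have hc1 : c ≤ m := min_le_left _ _
  have hc2 : c ≤ δ / R ^ 2 := (min_le_right _ _).trans (min_le_left _ _)
  have hc3 : c ≤ 1 / (2 * C) := (min_le_right _ _).trans (min_le_right _ _)
  have hc0 : 0 < c := by positivity
  have hpos : 0 < 1 + c * ξ ^ 2 := by positivity
  rw [← one_div, le_div_iff₀ hpos]
  change q ξ * _ ≤ 1
  rcases le_total |ξ| r with h | h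
  · have h1 : q ξ ≤ 1 - m * ξ ^ 2 := hlow ξ h
    have h2 : c * ξ ^ 2 ≤ m * ξ ^ 2 := by gcongr
    calc q ξ * (1 + c * ξ ^ 2) ≤ (1 - m * ξ ^ 2) * (1 + m * ξ ^ 2) :=
          mul_le_mul h1 (by linarith) hpos.le ((hq0 ξ).trans h1)
      _ ≤ 1 := by nlinarith [sq_nonneg (m * ξ ^ 2)]
  rcases le_total |ξ| R with h' | h'
  · have h1 := hmid ξ h h'
    have h2 : c * ξ ^ 2 ≤ δ := by
      have : ξ ^ 2 ≤ R ^ 2 := by rw [← sq_abs]; gcongr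
      calc c * ξ ^ 2 ≤ δ / R ^ 2 * R ^ 2 := by gcongr
        _ = δ := by field_simp
    exact (mul_le_mul_of_nonneg_left (by linarith) (hq0 ξ)).trans h1
  · have h1 : R ^ 2 ≤ ξ ^ 2 := by rw [← sq_abs ξ]; gcongr
    have h2 : 2 * C * q ξ ≤ ξ ^ 2 * q ξ := mul_le_mul_of_nonneg_right (by linarith) (hq0 ξ)
    have h3 : ξ ^ 2 * q ξ ≤ C := hhigh ξ
    have h4 : c * (ξ ^ 2 * q ξ) ≤ 1 / (2 * C) * C := by gcongr
    have h5 : 1 / (2 * C) * C = 1 / 2 := by field_simp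
    have h6 : q ξ ≤ 1 / 2 := by nlinarith
    nlinarith

/-! ### Convolution powers and the local limit bound. -/

/-- Iterated convolution powers, `convPow f n` being the `(n + 1)`-fold convolution power. -/
noncomputable def convPow (f : ℝ → ℝ) : ℕ → ℝ → ℝ
  | 0 => f
  | n + 1 => convolution f (convPow f n) (ContinuousLinearMap.mul ℝ ℝ) volume

theorem IsKernel.integrable_convPow {J : ℝ → ℝ} {d : ℝ} (hJ : IsKernel J d) (n : ℕ) :
    Integrable (convPow J n) := by
  induction n with
  | zero => exact hJ.integrable
  | succ n ih => exact hJ.integrable.integrable_convolution _ ih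

theorem IsKernel.continuous_convPow {J : ℝ → ℝ} {d : ℝ} (hJ : IsKernel J d) (n : ℕ) :
    Continuous (convPow J n) := by
  induction n with
  | zero => exact hJ.continuous
  | succ n ih =>
    exact hJ.hasCompactSupport.continuous_convolution_left _ hJ.continuous
      (hJ.integrable_convPow n).locallyIntegrable

theorem IsKernel.convPow_nonneg {J : ℝ → ℝ} {d : ℝ} (hJ : IsKernel J d) (n : ℕ) (x : ℝ) :
    0 ≤ convPow J n x := by
  induction n generalizing x with
  | zero => exact hJ.nonneg x
  | succ n ih => exact integral_nonneg fun y => mul_nonneg (hJ.nonneg y) (ih _)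

theorem IsKernel.fourier_convPow {J : ℝ → ℝ} {d : ℝ} (hJ : IsKernel J d) (n : ℕ) (ξ : ℝ) :
    𝓕 (fun x => (convPow J n x : ℂ)) ξ = 𝓕 (fun x => (J x : ℂ)) ξ ^ (n + 1) := by
  induction n with
  | zero => simp [convPow]
  | succ n ih =>
    have : (fun x => (convPow J (n + 1) x : ℂ)) = convolution (fun x => (J x : ℂ))
        (fun x => (convPow J n x : ℂ)) (ContinuousLinearMap.mul ℂ ℂ) volume := by
      ext x
      simp only [convPow, convolution, ContinuousLinearMap.mul_apply', ← integral_complex_ofReal,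
        Complex.ofReal_mul]
    rw [this, pow_succ' _ (n + 1), ← ih]
    exact Real.fourier_mul_convolution_eq hJ.integrable.ofReal
      (hJ.integrable_convPow n).ofReal ξ

theorem integrable_inv_one_add_mul_sq {c : ℝ} (hc : 0 < c) :
    Integrable (fun ξ : ℝ => (1 + c * ξ ^ 2)⁻¹) := by
  have h := integrable_inv_one_add_sq.comp_mul_left' (g := fun x : ℝ => (1 + x ^ 2)⁻¹)
    (R := √c) (by positivity)
  simpa [mul_pow, Real.sq_sqrt hc.le] using h

theorem integral_inv_one_add_mul_sq {c : ℝ} (hc : 0 < c) :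
    ∫ ξ : ℝ, (1 + c * ξ ^ 2)⁻¹ = Real.pi / √c := by
  have h := Measure.integral_comp_mul_left (fun x : ℝ => (1 + x ^ 2)⁻¹) (√c)
  simp only [mul_pow, Real.sq_sqrt hc.le, integral_univ_inv_one_add_sq, smul_eq_mul] at h
  rw [h, abs_of_pos (by positivity)]
  ring

/-- The convolution powers of the kernel obey the uniform local limit bound `O(n ^ (-1/2))`. -/
theorem IsKernel.convPow_le {J : ℝ → ℝ} {d : ℝ} (hJ : IsKernel J d) :
    ∃ C > 0, ∀ n x, convPow J n x ≤ C / √(n + 1) := by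
  obtain ⟨c, hc, hF⟩ := hJ.norm_fourier_le
  refine ⟨Real.pi / √c, by positivity, fun n x => ?_⟩
  have hcn : 0 < c * (n + 1) := by positivity
  have hb : ∀ ξ, ‖𝓕 (fun x => (convPow J n x : ℂ)) ξ‖ ≤ (1 + c * (n + 1) * ξ ^ 2)⁻¹ := by
    intro ξ
    rw [hJ.fourier_convPow, norm_pow]
    have h1 : 0 ≤ c * ξ ^ 2 := by positivity
    calc ‖𝓕 (fun x => (J x : ℂ)) ξ‖ ^ (n + 1) ≤ ((1 + c * ξ ^ 2)⁻¹) ^ (n + 1) := by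
          gcongr; exact hF ξ
      _ = ((1 + c * ξ ^ 2) ^ (n + 1))⁻¹ := inv_pow _ _
      _ ≤ (1 + c * (n + 1) * ξ ^ 2)⁻¹ := by
          refine inv_anti₀ (by positivity) ?_
          have := one_add_mul_le_pow (a := c * ξ ^ 2) (by linarith) (n + 1)
          push_cast at this
          linarith
  have hcont : Continuous (fun x => (convPow J n x : ℂ)) :=
    Complex.continuous_ofReal.comp (hJ.continuous_convPow n)
  have hint : Integrable (fun x => (convPow J n x : ℂ)) := (hJ.integrable_convPow n).ofReal
  have hFm : AEStronglyMeasurable (𝓕 (fun x => (convPow J n x : ℂ))) := by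
    have : 𝓕 (fun x => (convPow J n x : ℂ)) = fun ξ => 𝓕 (fun x => (J x : ℂ)) ξ ^ (n + 1) :=
      funext (hJ.fourier_convPow n)
    rw [this]
    exact (hJ.continuous_fourier.pow _).aestronglyMeasurable
  have hFi : Integrable (𝓕 (fun x => (convPow J n x : ℂ))) :=
    (integrable_inv_one_add_mul_sq hcn).mono' hFm (.of_forall hb)
  have hinv := congrFun (hcont.fourierInv_fourier_eq hint hFi) x
  have h1 : ‖𝓕⁻ (𝓕 (fun x => (convPow J n x : ℂ))) x‖
      ≤ ∫ ξ, ‖𝓕 (fun x => (convPow J n x : ℂ)) ξ‖ := by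
    rw [Real.fourierInv_eq]
    refine (norm_integral_le_integral_norm _).trans_eq ?_
    simp
  rw [hinv, Complex.norm_real, Real.norm_eq_abs, abs_of_nonneg (hJ.convPow_nonneg n x)] at h1
  refine h1.trans ((integral_mono hFi.norm (integrable_inv_one_add_mul_sq hcn) hb).trans_eq ?_)
  rw [integral_inv_one_add_mul_sq hcn, Real.sqrt_mul hc.le, div_div]

/-! ### Superharmonicity of `|x| + b`. -/

theorem IsKernel.integrable_sub_mul {J : ℝ → ℝ} {d : ℝ} (hJ : IsKernel J d) (x : ℝ) {g : ℝ → ℝ}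
    (hg : Continuous g) : Integrable (fun y => J (x - y) * g y) := by
  have := (hJ.integrable_mul (g := fun s => g (x - s)) (by fun_prop)).comp_sub_left x
  simpa using this

theorem IsKernel.integral_sub_left {J : ℝ → ℝ} {d : ℝ} (hJ : IsKernel J d) (x : ℝ) :
    ∫ y, J (x - y) = 1 := by
  rw [integral_sub_left_eq_self J volume x, hJ.integral_eq_one]

theorem IsKernel.integral_sub_mul_id {J : ℝ → ℝ} {d : ℝ} (hJ : IsKernel J d) (x : ℝ) :
    ∫ y, J (x - y) * y = x := by
  have h1 : ∫ s, J s * s = 0 := by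
    have h := integral_neg_eq_self (fun s => J s * s) volume
    simp only [hJ.even, mul_neg, integral_neg] at h
    linarith
  have h2 := integral_sub_left_eq_self (fun s => J s * (x - s)) volume x
  simp only [sub_sub_cancel] at h2
  rw [h2]
  simp only [mul_sub]
  rw [integral_sub (hJ.integrable.mul_const x) (hJ.integrable_mul continuous_id'),
    integral_mul_const, hJ.integral_eq_one, h1]
  ring

/-- Superharmonicity of `|·| + b` at points `x ≥ 0` for the hole `(-a₀, a₀)`: the convexity defect
of `|·|` is compensated by the killing in the hole. -/
theorem IsKernel.integral_indicator_abs_le_of_nonneg {J : ℝ → ℝ} {d : ℝ} (hJ : IsKernel J d)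
    {a₀ b : ℝ} (ha₀ : 0 < a₀) (hb : 2 * (d ^ 2 + a₀ ^ 2) ≤ b * a₀) {x : ℝ} (hx : 0 ≤ x) :
    ∫ y, J (x - y) * (Ioo (-a₀) a₀)ᶜ.indicator (fun y => |y| + b) y ≤ x + b := by
  have hd := hJ.radius_pos
  have hb2 : 2 * a₀ ≤ b := by
    by_contra! h
    nlinarith [mul_pos ha₀ (sub_pos.2 h), sq_nonneg d]
  -- By monotonicity `J (x - y) ≥ A` for `y ∈ (-a₀, 0]` and `J (x - y) ≤ A` for `y ≤ -a₀`, so `A`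
  -- compares the gain from killing with the loss from convexity.
  set A := J (x + a₀) with hA
  have hA0 : 0 ≤ A := hJ.nonneg _
  set P := ∫ y, (Ioc (-a₀) 0).indicator (fun y => J (x - y)) y with hP
  have hJi : Integrable (fun y => J (x - y)) := hJ.integrable.comp_sub_left x
  have hiP : Integrable ((Ioc (-a₀) 0).indicator (fun y => J (x - y))) :=
    hJi.indicator measurableSet_Ioc
  have hiA : Integrable ((Icc (-d) 0).indicator (fun _ => A * d)) :=
    (integrableOn_const (by simp)).integrable_indicator measurableSet_Icc
  have hAP : A * a₀ ≤ P := by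
    have e : A * a₀ = ∫ y, (Ioc (-a₀) 0).indicator (fun _ => A) y := by
      rw [integral_indicator measurableSet_Ioc]
      simp [ha₀.le, mul_comm]
    rw [e]
    refine integral_mono ((integrableOn_const (by simp)).integrable_indicator measurableSet_Ioc)
      hiP fun y => ?_
    refine indicator_le_indicator' fun hy => ?_
    refine hJ.antitoneOn (mem_Ici.2 ?_) (mem_Ici.2 ?_) ?_ <;> linarith [hy.1, hy.2]
  -- Comparison with the linear function `y + b`, whose average is exactly `x + b`. On `[-d, -a₀]`
  -- the excess is `2|y| J (x - y) ≤ 2Ad`; on `(-a₀, 0]` killing saves at least `(b - 2a₀) J (x -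
  -- y)`. In total `2Ad²` must be at most `(b - 2a₀) A a₀`, which is `hb`.
  have hpt : ∀ y, J (x - y) * (Ioo (-a₀) a₀)ᶜ.indicator (fun y => |y| + b) y
      ≤ (J (x - y) * y + b * J (x - y)) + (2 * (Icc (-d) 0).indicator (fun _ => A * d) y
        - (b - 2 * a₀) * (Ioc (-a₀) 0).indicator (fun y => J (x - y)) y) := by
    intro y
    have hj := hJ.nonneg (x - y)
    rcases lt_or_ge 0 y with hy | hy
    · have h1 : y ∉ Icc (-d) 0 := fun h => absurd h.2 (not_le.2 hy)
      have h2 : y ∉ Ioc (-a₀) 0 := fun h => absurd h.2 (not_le.2 hy)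
      rw [indicator_of_notMem h1, indicator_of_notMem h2]
      have h3 : (Ioo (-a₀) a₀)ᶜ.indicator (fun y => |y| + b) y ≤ y + b := by
        refine (indicator_le_self' (fun z _ => by linarith [abs_nonneg z]) y).trans ?_
        rw [abs_of_pos hy]
      nlinarith
    have hA1 : 0 ≤ (Icc (-d) 0).indicator (fun _ => A * d) y :=
      indicator_nonneg (fun _ _ => by positivity) y
    rcases lt_or_ge (-a₀) y with hy' | hy'
    · have h1 : y ∉ (Ioo (-a₀) a₀)ᶜ := fun h => h ⟨hy', by linarith⟩
      have h2 : y ∈ Ioc (-a₀) 0 := ⟨hy', hy⟩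
      rw [indicator_of_notMem h1, indicator_of_mem h2]
      nlinarith
    · have h1 : y ∈ (Ioo (-a₀) a₀)ᶜ := fun h => absurd h.1 (not_lt.2 hy')
      have h2 : y ∉ Ioc (-a₀) 0 := fun h => absurd h.1 (not_lt.2 hy')
      rw [indicator_of_mem h1, indicator_of_notMem h2, abs_of_nonpos hy]
      rcases le_or_gt (-d) y with hyd | hyd
      · rw [indicator_of_mem (show y ∈ Icc (-d) 0 from ⟨hyd, hy⟩)]
        have h3 : J (x - y) ≤ A :=
          hJ.antitoneOn (mem_Ici.2 (by linarith)) (mem_Ici.2 (by linarith)) (by linarith)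
        have h4 : J (x - y) * (-y) ≤ A * d := mul_le_mul h3 (by linarith) (by linarith) hA0
        nlinarith
      · have h3 : J (x - y) = 0 := hJ.eq_zero_of_le_abs (by
          rw [abs_of_nonneg (by linarith)]; linarith)
        rw [h3]
        linarith
  have hi1 : Integrable (fun y => J (x - y) * y) := hJ.integrable_sub_mul x continuous_id'
  have hiL : Integrable (fun y => J (x - y) * (Ioo (-a₀) a₀)ᶜ.indicator (fun y => |y| + b) y) := by
    have e : (fun y => J (x - y) * (Ioo (-a₀) a₀)ᶜ.indicator (fun y => |y| + b) y)
        = (Ioo (-a₀) a₀)ᶜ.indicator (fun y => J (x - y) * (|y| + b)) := by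
      ext y; simp only [indicator_apply]; split_ifs <;> simp
    rw [e]
    exact (hJ.integrable_sub_mul x (by fun_prop)).indicator measurableSet_Ioo.compl
  refine (integral_mono hiL ((hi1.add (hJi.const_mul b)).add
    ((hiA.const_mul 2).sub (hiP.const_mul (b - 2 * a₀)))) hpt).trans ?_
  rw [integral_add' (hi1.add (hJi.const_mul b)) ((hiA.const_mul 2).sub (hiP.const_mul (b - 2 * a₀))),
    integral_add' hi1 (hJi.const_mul b),
    integral_sub' (hiA.const_mul 2) (hiP.const_mul (b - 2 * a₀)), integral_const_mul,
    integral_const_mul, integral_const_mul, hJ.integral_sub_mul_id, hJ.integral_sub_left,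
    integral_indicator measurableSet_Icc, ← hP]
  have e2 : ∫ _ in Icc (-d) 0, A * d = A * d * d := by simp [hd.le, mul_comm]
  rw [e2]
  have h5 : (b - 2 * a₀) * (A * a₀) ≤ (b - 2 * a₀) * P :=
    mul_le_mul_of_nonneg_left hAP (by linarith)
  nlinarith [mul_le_mul_of_nonneg_left hb hA0]

theorem IsKernel.integral_indicator_abs_le {J : ℝ → ℝ} {d : ℝ} (hJ : IsKernel J d)
    {a₀ b : ℝ} (ha₀ : 0 < a₀) (hb : 2 * (d ^ 2 + a₀ ^ 2) ≤ b * a₀) (x : ℝ) :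
    ∫ y, J (x - y) * (Ioo (-a₀) a₀)ᶜ.indicator (fun y => |y| + b) y ≤ |x| + b := by
  rcases le_total 0 x with hx | hx
  · rw [abs_of_nonneg hx]
    exact hJ.integral_indicator_abs_le_of_nonneg ha₀ hb hx
  · rw [abs_of_nonpos hx, ← integral_neg_eq_self]
    refine le_trans (le_of_eq ?_)
      (hJ.integral_indicator_abs_le_of_nonneg ha₀ hb (neg_nonneg.2 hx))
    congr 1 with y
    have e1 : J (x - -y) = J (-x - y) := by rw [← hJ.even]; congr 1; ring
    have e2 : (Ioo (-a₀) a₀)ᶜ.indicator (fun y => |y| + b) (-y)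
        = (Ioo (-a₀) a₀)ᶜ.indicator (fun y => |y| + b) y := by
      have : -y ∈ (Ioo (-a₀) a₀)ᶜ ↔ y ∈ (Ioo (-a₀) a₀)ᶜ := by
        simp only [mem_compl_iff, mem_Ioo]
        exact not_congr ⟨fun h => ⟨by linarith [h.2], by linarith [h.1]⟩,
          fun h => ⟨by linarith [h.2], by linarith [h.1]⟩⟩
      simp only [indicator_apply, this, abs_neg]
    rw [e1, e2]

/-! ### The killed walk: symmetry, moments, smoothing. -/

/-- One step of the random walk with jump density `J` killed in `H`, on nonnegative functions. -/
noncomputable def killedOp (H : Set ℝ) (J : ℝ → ℝ) (g : ℝ → ℝ≥0∞) (x : ℝ) : ℝ≥0∞ :=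
  ∫⁻ y in Hᶜ, ENNReal.ofReal (J (x - y)) * g y

theorem measurable_killedOp {H : Set ℝ} {J : ℝ → ℝ} (hJ : Measurable J) {g : ℝ → ℝ≥0∞}
    (hg : Measurable g) : Measurable (killedOp H J g) := by
  unfold killedOp
  exact Measurable.lintegral_prod_right' (f := fun p : ℝ × ℝ =>
    ENNReal.ofReal (J (p.1 - p.2)) * g p.2) (by fun_prop)

theorem measurable_killedOp_iterate {H : Set ℝ} {J : ℝ → ℝ} (hJ : Measurable J) {g : ℝ → ℝ≥0∞}
    (hg : Measurable g) (n : ℕ) : Measurable ((killedOp H J)^[n] g) := by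
  induction n with
  | zero => exact hg
  | succ n ih => rw [Function.iterate_succ_apply']; exact measurable_killedOp hJ ih

theorem killedOp_mono {H : Set ℝ} {J : ℝ → ℝ} : Monotone (killedOp H J) := fun _ _ h _ =>
  lintegral_mono fun y => mul_le_mul_right (h y) _

theorem killedOp_const_mul {H : Set ℝ} {J : ℝ → ℝ} (hJ : Measurable J) {g : ℝ → ℝ≥0∞}
    (hg : Measurable g) (c : ℝ≥0∞) (x : ℝ) :
    killedOp H J (fun y => c * g y) x = c * killedOp H J g x := by
  unfold killedOp
  rw [← lintegral_const_mul _ (by fun_prop)]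
  exact lintegral_congr fun y => by ring

theorem killedOp_iterate_const {H : Set ℝ} {J : ℝ → ℝ} (hJ : Measurable J) (c : ℝ≥0∞) (n : ℕ)
    (x : ℝ) : (killedOp H J)^[n] (fun _ => c) x = c * (killedOp H J)^[n] (fun _ => 1) x := by
  induction n generalizing x with
  | zero => simp
  | succ n ih =>
    rw [Function.iterate_succ_apply', Function.iterate_succ_apply',
      ← killedOp_const_mul hJ (measurable_killedOp_iterate hJ measurable_const n)]
    congr 1
    exact funext ih

theorem lintegral_killedOp_mul {H : Set ℝ} {J : ℝ → ℝ} (hJ : Measurable J)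
    (heven : ∀ x, J (-x) = J x) {g h : ℝ → ℝ≥0∞} (hg : Measurable g) (hh : Measurable h) :
    ∫⁻ x in Hᶜ, killedOp H J g x * h x = ∫⁻ x in Hᶜ, g x * killedOp H J h x := by
  unfold killedOp
  have e1 : ∀ x, (∫⁻ y in Hᶜ, ENNReal.ofReal (J (x - y)) * g y) * h x
      = ∫⁻ y in Hᶜ, ENNReal.ofReal (J (x - y)) * g y * h x := fun x =>
    (lintegral_mul_const _ (by fun_prop)).symm
  have e2 : ∀ x, g x * (∫⁻ y in Hᶜ, ENNReal.ofReal (J (x - y)) * h y)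
      = ∫⁻ y in Hᶜ, g x * (ENNReal.ofReal (J (x - y)) * h y) := fun x =>
    (lintegral_const_mul _ (by fun_prop)).symm
  simp only [e1, e2]
  rw [lintegral_lintegral_swap (by fun_prop)]
  refine lintegral_congr fun x => lintegral_congr fun y => ?_
  rw [← heven (x - y), neg_sub]
  ring

theorem lintegral_killedOp_iterate_mul {H : Set ℝ} {J : ℝ → ℝ} (hJ : Measurable J)
    (heven : ∀ x, J (-x) = J x) (n : ℕ) {g h : ℝ → ℝ≥0∞} (hg : Measurable g)
    (hh : Measurable h) :
    ∫⁻ x in Hᶜ, (killedOp H J)^[n] g x * h x = ∫⁻ x in Hᶜ, g x * (killedOp H J)^[n] h x := by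
  induction n generalizing h with
  | zero => rfl
  | succ n ih =>
    rw [Function.iterate_succ_apply', Function.iterate_succ_apply,
      lintegral_killedOp_mul hJ heven (measurable_killedOp_iterate hJ hg n) hh,
      ih (measurable_killedOp hJ hh)]

theorem IsKernel.lintegral_sub_left {J : ℝ → ℝ} {d : ℝ} (hJ : IsKernel J d) (x : ℝ) :
    ∫⁻ y, ENNReal.ofReal (J (x - y)) = 1 := by
  rw [← ofReal_integral_eq_lintegral_ofReal (hJ.integrable.comp_sub_left x)
    (.of_forall fun y => hJ.nonneg _), hJ.integral_sub_left, ENNReal.ofReal_one]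

/-- `|·| + b` is superharmonic for the killed walk when `b` is large. -/
theorem IsKernel.killedOp_abs_le {J : ℝ → ℝ} {d : ℝ} (hJ : IsKernel J d) {H : Set ℝ} {a₀ b : ℝ}
    (ha₀ : 0 < a₀) (hH : Ioo (-a₀) a₀ ⊆ H) (hb0 : 0 ≤ b) (hb : 2 * (d ^ 2 + a₀ ^ 2) ≤ b * a₀)
    (x : ℝ) :
    killedOp H J (fun y => ENNReal.ofReal (|y| + b)) x ≤ ENNReal.ofReal (|x| + b) := by
  have h1 : killedOp H J (fun y => ENNReal.ofReal (|y| + b)) x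
      ≤ ∫⁻ y in (Ioo (-a₀) a₀)ᶜ, ENNReal.ofReal (J (x - y) * (|y| + b)) := by
    unfold killedOp
    refine (lintegral_mono_set (compl_subset_compl.2 hH)).trans_eq ?_
    exact lintegral_congr fun y => (ENNReal.ofReal_mul (hJ.nonneg _)).symm
  refine h1.trans ?_
  rw [← ofReal_integral_eq_lintegral_ofReal
    (hJ.integrable_sub_mul x (g := fun y => |y| + b) (by fun_prop)).integrableOn
    (.of_forall fun y => mul_nonneg (hJ.nonneg _) (by positivity))]
  refine ENNReal.ofReal_le_ofReal (le_trans (le_of_eq ?_) (hJ.integral_indicator_abs_le ha₀ hb x))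
  rw [← integral_indicator measurableSet_Ioo.compl]
  congr 1 with y
  simp only [indicator_apply]
  split_ifs <;> simp

/-- By symmetry a step can be moved onto `φ`, where superharmonicity only decreases the integral. -/
theorem lintegral_killedOp_iterate_mul_le {H : Set ℝ} {J : ℝ → ℝ} (hJ : Measurable J)
    (heven : ∀ x, J (-x) = J x) {φ : ℝ → ℝ≥0∞} (hφ : Measurable φ)
    (hsup : ∀ x, killedOp H J φ x ≤ φ x) {g : ℝ → ℝ≥0∞} (hg : Measurable g) (n : ℕ) :
    ∫⁻ x in Hᶜ, (killedOp H J)^[n] g x * φ x ≤ ∫⁻ x in Hᶜ, g x * φ x := by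
  induction n with
  | zero => rfl
  | succ n ih =>
    rw [Function.iterate_succ_apply',
      lintegral_killedOp_mul hJ heven (measurable_killedOp_iterate hJ hg n) hφ]
    exact (lintegral_mono fun x => mul_le_mul_right (hsup x) _).trans ih

/-- Forgetting the killing at intermediate times leaves the free walk. The index shifts because
`convPow J n` is the density after `n + 1` steps. -/
theorem IsKernel.killedOp_iterate_le_convPow {J : ℝ → ℝ} {d : ℝ} (hJ : IsKernel J d)
    (H : Set ℝ) {g : ℝ → ℝ≥0∞} (hg : Measurable g) (n : ℕ) (x : ℝ) :
    (killedOp H J)^[n + 1] g x ≤ ∫⁻ y in Hᶜ, ENNReal.ofReal (convPow J n (x - y)) * g y := by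
  have hm : ∀ n, Measurable (convPow J n) := fun n => (hJ.continuous_convPow n).measurable
  have hJm := hJ.continuous.measurable
  induction n generalizing x with
  | zero => exact le_rfl
  | succ n ih =>
    rw [Function.iterate_succ_apply']
    have := hm n
    calc killedOp H J ((killedOp H J)^[n + 1] g) x
        ≤ ∫⁻ z in Hᶜ, ENNReal.ofReal (J (x - z)) *
            ∫⁻ y in Hᶜ, ENNReal.ofReal (convPow J n (z - y)) * g y :=
          killedOp_mono (show (killedOp H J)^[n + 1] g ≤ _ from ih) x
      _ = ∫⁻ z in Hᶜ, ∫⁻ y in Hᶜ, ENNReal.ofReal (J (x - z)) *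
            (ENNReal.ofReal (convPow J n (z - y)) * g y) :=
          lintegral_congr fun z => (lintegral_const_mul _ (by fun_prop)).symm
      _ = ∫⁻ y in Hᶜ, ∫⁻ z in Hᶜ, ENNReal.ofReal (J (x - z)) *
            (ENNReal.ofReal (convPow J n (z - y)) * g y) :=
          lintegral_lintegral_swap (by fun_prop)
      _ ≤ ∫⁻ y in Hᶜ, ENNReal.ofReal (convPow J (n + 1) (x - y)) * g y := by
          refine lintegral_mono fun y => ?_
          simp only [← mul_assoc]
          rw [lintegral_mul_const _ (by fun_prop)]
          refine mul_le_mul_left ?_ _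
          refine (lintegral_mono' Measure.restrict_le_self le_rfl).trans ?_
          rw [← lintegral_sub_left_eq_self _ x]
          simp only [sub_sub_cancel, ← ENNReal.ofReal_mul (hJ.nonneg _)]
          have hc : ConvolutionExistsAt J (convPow J n) (x - y) (ContinuousLinearMap.mul ℝ ℝ) :=
            hJ.hasCompactSupport.convolutionExists_left _ hJ.continuous
              (hJ.integrable_convPow n).locallyIntegrable _
          have hc' : Integrable (fun t => J t * convPow J n (x - y - t)) := hc
          rw [convPow, convolution]
          simp only [ContinuousLinearMap.mul_apply']
          rw [ofReal_integral_eq_lintegral_ofReal hc'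
            (.of_forall fun t => mul_nonneg (hJ.nonneg t) (hJ.convPow_nonneg n _))]
          refine le_of_eq (lintegral_congr fun t => ?_)
          rw [sub_right_comm]

theorem IsKernel.killedOp_iterate_le_lintegral {J : ℝ → ℝ} {d : ℝ} (hJ : IsKernel J d)
    (H : Set ℝ) : ∃ C > 0, ∀ (g : ℝ → ℝ≥0∞), Measurable g → ∀ (n : ℕ) (x : ℝ),
      (killedOp H J)^[n + 1] g x ≤ ENNReal.ofReal (C / √(n + 1)) * ∫⁻ y in Hᶜ, g y := by
  obtain ⟨C, hC, h⟩ := hJ.convPow_le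
  refine ⟨C, hC, fun g hg n x => (hJ.killedOp_iterate_le_convPow H hg n x).trans ?_⟩
  rw [← lintegral_const_mul _ hg]
  exact lintegral_mono fun y => mul_le_mul_left (ENNReal.ofReal_le_ofReal (h n _)) _

/-! ### Decay of mass, survival probability and pointwise decay. -/

/-- A splitting estimate for the mass: the part in `[-R, R]` is controlled by the supremum and the
rest by the first moment. -/
theorem lintegral_le_sup_add_moment {H : Set ℝ} {w : ℝ → ℝ≥0∞} {B : ℝ≥0∞} (hwB : ∀ x, w x ≤ B)
    (hw : Measurable w) {R b : ℝ} (hR : 0 < R) (hb : 0 ≤ b) :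
    ∫⁻ x in Hᶜ, w x ≤ ENNReal.ofReal (2 * R) * B
      + ENNReal.ofReal (1 / R) * ∫⁻ x in Hᶜ, w x * ENNReal.ofReal (|x| + b) := by
  have hpt : ∀ x, w x ≤ (Icc (-R) R).indicator (fun _ => B) x
      + ENNReal.ofReal (1 / R) * (w x * ENNReal.ofReal (|x| + b)) := by
    intro x
    by_cases hx : x ∈ Icc (-R) R
    · rw [indicator_of_mem hx]
      exact (hwB x).trans le_self_add
    · rw [indicator_of_notMem hx, zero_add]
      have h1 : R < |x| := by
        by_contra! h
        exact hx (abs_le.1 h)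
      calc w x = w x * 1 := (mul_one _).symm
        _ ≤ w x * (ENNReal.ofReal (1 / R) * ENNReal.ofReal (|x| + b)) := by
            refine mul_le_mul_right ?_ _
            rw [← ENNReal.ofReal_mul (by positivity), ← ENNReal.ofReal_one]
            refine ENNReal.ofReal_le_ofReal ?_
            rw [div_mul_eq_mul_div, one_mul, le_div_iff₀ hR]
            linarith
        _ = _ := by ring
  refine (lintegral_mono hpt).trans ?_
  rw [lintegral_add_left (by fun_prop (disch := measurability)), lintegral_const_mul _ (by fun_prop)]
  refine add_le_add_left ?_ _
  refine (lintegral_mono' Measure.restrict_le_self le_rfl).trans ?_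
  rw [lintegral_indicator measurableSet_Icc, setLIntegral_const, Real.volume_Icc, mul_comm]
  refine le_of_eq ?_
  congr 2
  ring

/-- Closes the induction for the mass with radius `R = √N / (16 C₁)`: the first term is at most half
of `C₂ / √N`, and the second is `16 C₁ / √N`, at most the other half once `C₂ ≥ 32 C₁`. -/
theorem mass_recursion_real {C₁ C₂ : ℝ} (hC₁ : 0 < C₁) (hC₂ : 32 * C₁ ≤ C₂) {N p q : ℝ}
    (hN : 0 < N) (hp : N ≤ 4 * p) (hq : N ≤ 4 * q) :
    2 * (√N / (16 * C₁)) * (C₁ / √p * (C₂ / √q)) + 1 / (√N / (16 * C₁)) ≤ C₂ / √N := by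
  have hs : 0 < √N := Real.sqrt_pos.2 hN
  have h1 : √N / 2 ≤ √p := by
    apply Real.le_sqrt_of_sq_le
    rw [div_pow, Real.sq_sqrt hN.le]; linarith
  have h2 : √N / 2 ≤ √q := by
    apply Real.le_sqrt_of_sq_le
    rw [div_pow, Real.sq_sqrt hN.le]; linarith
  have hC₂0 : 0 < C₂ := by linarith
  calc 2 * (√N / (16 * C₁)) * (C₁ / √p * (C₂ / √q)) + 1 / (√N / (16 * C₁))
      ≤ 2 * (√N / (16 * C₁)) * (C₁ / (√N / 2) * (C₂ / (√N / 2))) + 1 / (√N / (16 * C₁)) := by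
        gcongr
    _ = (C₂ / 2 + 16 * C₁) / √N := by field_simp; ring
    _ ≤ C₂ / √N := by gcongr; linarith

/-- The mass of the killed walk decays like `n ^ (-1/2)`, with a constant linear in the first
moment of the initial distribution. -/
theorem IsKernel.lintegral_killedOp_iterate_le {J : ℝ → ℝ} {d : ℝ} (hJ : IsKernel J d)
    {H : Set ℝ} {b : ℝ} (hb : 0 < b)
    (hsup : ∀ x, killedOp H J (fun y => ENNReal.ofReal (|y| + b)) x ≤ ENNReal.ofReal (|x| + b)) :
    ∃ C > 0, ∀ (g : ℝ → ℝ≥0∞), Measurable g → ∀ n : ℕ,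
      ∫⁻ x in Hᶜ, (killedOp H J)^[n] g x
        ≤ ENNReal.ofReal (C / √(n + 1)) * ∫⁻ x in Hᶜ, g x * ENNReal.ofReal (|x| + b) := by
  obtain ⟨C₁, hC₁, hsm⟩ := hJ.killedOp_iterate_le_lintegral H
  have hJm := hJ.continuous.measurable
  refine ⟨max (32 * C₁) (1 / b), by positivity, fun g hg n => ?_⟩
  set C₂ := max (32 * C₁) (1 / b)
  have hC₂ : 32 * C₁ ≤ C₂ := le_max_left _ _
  have hC₂b : 1 / b ≤ C₂ := le_max_right _ _
  set Φ := ∫⁻ x in Hᶜ, g x * ENNReal.ofReal (|x| + b)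
  induction n using Nat.strong_induction_on with
  | _ n ih =>
  rcases n with _ | n
  · simp only [Function.iterate_zero, id_eq, Nat.cast_zero, zero_add, Real.sqrt_one, div_one]
    rw [← lintegral_const_mul _ (by fun_prop)]
    refine lintegral_mono fun x => ?_
    calc g x = g x * 1 := (mul_one _).symm
      _ ≤ g x * (ENNReal.ofReal C₂ * ENNReal.ofReal (|x| + b)) := by
          refine mul_le_mul_right ?_ _
          rw [← ENNReal.ofReal_mul (by positivity), ← ENNReal.ofReal_one]
          refine ENNReal.ofReal_le_ofReal ?_
          calc (1:ℝ) = 1 / b * (0 + b) := by field_simp; ring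
            _ ≤ C₂ * (|x| + b) := by gcongr; exact abs_nonneg x
      _ = _ := by ring
  -- The last `j + 1` steps smooth, the first `l` use the induction hypothesis. Both counts are at
  -- least a quarter of `n + 2`, as `mass_recursion_real` requires.
  · set j := n / 2 with hj
    obtain ⟨l, hl⟩ : ∃ l, n = j + l := ⟨n - j, by omega⟩
    have hm := measurable_killedOp_iterate (H := H) hJm hg
    have hB : ∀ x, (killedOp H J)^[n + 1] g x
        ≤ ENNReal.ofReal (C₁ / √(j + 1)) * (ENNReal.ofReal (C₂ / √(l + 1)) * Φ) := by
      intro x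
      have e : n + 1 = (j + 1) + l := by omega
      rw [e, Function.iterate_add_apply]
      exact (hsm _ (hm l) j x).trans (mul_le_mul_right (ih l (by omega)) _)
    set N : ℝ := ((n + 1 : ℕ) : ℝ) + 1 with hN
    have hN0 : 0 < N := by positivity
    have hR : 0 < √N / (16 * C₁) := by positivity
    refine (lintegral_le_sup_add_moment hB (hm (n + 1)) hR hb.le).trans ?_
    refine (add_le_add_right (mul_le_mul_right (lintegral_killedOp_iterate_mul_le hJm hJ.even
      (by fun_prop) hsup hg (n + 1)) _) _).trans ?_
    rw [← mul_assoc, ← mul_assoc, ← ENNReal.ofReal_mul (by positivity),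
      ← ENNReal.ofReal_mul (by positivity), ← add_mul, ← ENNReal.ofReal_add (by positivity)
      (by positivity)]
    refine mul_le_mul_left (ENNReal.ofReal_le_ofReal ?_) _
    rw [mul_assoc]
    have h1 : n + 2 ≤ 4 * (j + 1) := by omega
    have h2 : n + 2 ≤ 4 * (l + 1) := by omega
    refine mass_recursion_real hC₁ hC₂ hN0 ?_ ?_
    · rw [hN]; push_cast; have : ((n + 2 : ℕ) : ℝ) ≤ ((4 * (j + 1) : ℕ) : ℝ) := by exact_mod_cast h1
      push_cast at this; linarith
    · rw [hN]; push_cast; have : ((n + 2 : ℕ) : ℝ) ≤ ((4 * (l + 1) : ℕ) : ℝ) := by exact_mod_cast h2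
      push_cast at this; linarith

/-- Survival probabilities of the killed walk. -/
theorem IsKernel.killedOp_iterate_one_le {J : ℝ → ℝ} {d : ℝ} (hJ : IsKernel J d)
    {H : Set ℝ} {b : ℝ} (hb : 0 < b)
    (hsup : ∀ x, killedOp H J (fun y => ENNReal.ofReal (|y| + b)) x ≤ ENNReal.ofReal (|x| + b)) :
    ∃ C > 0, ∀ (n : ℕ) (x : ℝ), (killedOp H J)^[n] (fun _ => 1) x
        ≤ ENNReal.ofReal (C / √(n + 1)) * ENNReal.ofReal (|x| + b) := by
  obtain ⟨C, hC, hmass⟩ := hJ.lintegral_killedOp_iterate_le hb hsup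
  have hJm := hJ.continuous.measurable
  refine ⟨max (2 * C) (1 / b), by positivity, fun n x => ?_⟩
  set C' := max (2 * C) (1 / b)
  rcases n with _ | n
  · simp only [Function.iterate_zero, id_eq, Nat.cast_zero, zero_add, Real.sqrt_one, div_one]
    rw [← ENNReal.ofReal_mul (by positivity), ← ENNReal.ofReal_one]
    refine ENNReal.ofReal_le_ofReal ?_
    calc (1:ℝ) = 1 / b * (0 + b) := by field_simp; ring
      _ ≤ C' * (|x| + b) := by gcongr; exacts [le_max_right _ _, abs_nonneg x]
  · have hkm : Measurable fun y => ENNReal.ofReal (J (x - y)) := by fun_prop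
    -- By symmetry, survival for `n + 1` steps from `x` is the mass after `n` steps from the density
    -- `J (x - ·)`, whose moment against `|y| + b` is at most `|x| + b` by `hsup`.
    have h1 := lintegral_killedOp_iterate_mul (H := H) hJm hJ.even n hkm
      (measurable_const (a := (1 : ℝ≥0∞)))
    rw [Function.iterate_succ_apply']
    have h2 : killedOp H J ((killedOp H J)^[n] fun _ => 1) x
        = ∫⁻ y in Hᶜ, (killedOp H J)^[n] (fun y => ENNReal.ofReal (J (x - y))) y := by
      rw [killedOp, ← h1]
      simp only [mul_one]
    rw [h2]
    refine (hmass _ hkm n).trans ?_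
    refine mul_le_mul' (ENNReal.ofReal_le_ofReal ?_) (hsup x)
    have h3 : √(((n + 1 : ℕ) : ℝ) + 1) ≤ 2 * √((n : ℝ) + 1) := by
      rw [Real.sqrt_le_left (by positivity), mul_pow, Real.sq_sqrt (by positivity)]
      push_cast
      linarith [(Nat.cast_nonneg n : (0:ℝ) ≤ n)]
    rw [div_le_div_iff₀ (by positivity) (by positivity)]
    calc C * √(((n + 1 : ℕ) : ℝ) + 1) ≤ C * (2 * √((n : ℝ) + 1)) := by gcongr
      _ = 2 * C * √((n : ℝ) + 1) := by ring
      _ ≤ C' * √((n : ℝ) + 1) := by gcongr; exact le_max_left _ _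

/-- Pointwise decay `O(n ^ (-3/2))` for the killed walk. -/
theorem IsKernel.killedOp_iterate_le {J : ℝ → ℝ} {d : ℝ} (hJ : IsKernel J d)
    {H : Set ℝ} {b : ℝ} (hb : 0 < b)
    (hsup : ∀ x, killedOp H J (fun y => ENNReal.ofReal (|y| + b)) x ≤ ENNReal.ofReal (|x| + b)) :
    ∃ C > 0, ∀ (g : ℝ → ℝ≥0∞), Measurable g → ∀ (n : ℕ) (x : ℝ),
      (killedOp H J)^[n + 1] g x ≤ ENNReal.ofReal (C / √(n + 1) ^ 3 * (|x| + b))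
        * ∫⁻ x in Hᶜ, g x * ENNReal.ofReal (|x| + b) := by
  obtain ⟨C₁, hC₁, hsm⟩ := hJ.killedOp_iterate_le_lintegral H
  obtain ⟨C₂, hC₂, hmass⟩ := hJ.lintegral_killedOp_iterate_le hb hsup
  obtain ⟨C₃, hC₃, hone⟩ := hJ.killedOp_iterate_one_le hb hsup
  have hJm := hJ.continuous.measurable
  refine ⟨8 * (C₁ * C₂ * C₃), by positivity, fun g hg n x => ?_⟩
  set Φ := ∫⁻ x in Hᶜ, g x * ENNReal.ofReal (|x| + b)
  -- Reading from the datum: `l` steps for mass decay, `i + 1` for smoothing to the constant `B`,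
  -- and `i` for survival from `x`.
  set i := n / 3 with hi
  obtain ⟨l, hl⟩ : ∃ l, n = i + (i + l) := ⟨n - 2 * i, by omega⟩
  have e : n + 1 = i + ((i + 1) + l) := by omega
  have hm := measurable_killedOp_iterate (H := H) hJm hg
  set B := ENNReal.ofReal (C₁ / √(i + 1)) * (ENNReal.ofReal (C₂ / √(l + 1)) * Φ) with hB
  have h1 : (killedOp H J)^[i + 1 + l] g ≤ fun _ => B := fun y => by
    rw [Function.iterate_add_apply]
    exact (hsm _ (hm l) i y).trans (mul_le_mul_right (hmass g hg l) _)
  rw [e, Function.iterate_add_apply]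
  refine (killedOp_mono.iterate i h1 x).trans ?_
  rw [killedOp_iterate_const hJm]
  refine (mul_le_mul_right (hone i x) _).trans ?_
  have e2 : B * (ENNReal.ofReal (C₃ / √(i + 1)) * ENNReal.ofReal (|x| + b))
      = ENNReal.ofReal (C₁ / √(i + 1) * (C₂ / √(l + 1)) * (C₃ / √(i + 1)) * (|x| + b)) * Φ := by
    rw [hB, ENNReal.ofReal_mul (by positivity), ENNReal.ofReal_mul (by positivity),
      ENNReal.ofReal_mul (by positivity)]
    ring
  rw [e2]
  refine mul_le_mul_left (ENNReal.ofReal_le_ofReal ?_) _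
  have hs : ∀ k : ℕ, i ≤ k → √((n : ℝ) + 1) / 2 ≤ √((k : ℝ) + 1) := by
    intro k hk
    apply Real.le_sqrt_of_sq_le
    rw [div_pow, Real.sq_sqrt (by positivity)]
    have h : n + 1 ≤ 4 * (k + 1) := by omega
    have h' : ((n + 1 : ℕ) : ℝ) ≤ ((4 * (k + 1) : ℕ) : ℝ) := by exact_mod_cast h
    push_cast at h'
    linarith
  have hsi := hs i le_rfl
  have hsl := hs l (by omega)
  have hs0 : 0 < √((n : ℝ) + 1) := by positivity
  calc C₁ / √(i + 1) * (C₂ / √(l + 1)) * (C₃ / √(i + 1)) * (|x| + b)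
      ≤ C₁ / (√(n + 1) / 2) * (C₂ / (√(n + 1) / 2)) * (C₃ / (√(n + 1) / 2)) * (|x| + b) := by
        gcongr
    _ = 8 * (C₁ * C₂ * C₃) / √(n + 1) ^ 3 * (|x| + b) := by field_simp; ring

/-! ### The killed step as a bounded operator on the weighted space. -/

theorem measurable_weight : Measurable fun x : ℝ => ENNReal.ofReal (1 + x ^ 2) := by fun_prop

theorem lintegral_weightedMeasure {f : ℝ → ℝ≥0∞} (hf : Measurable f) :
    ∫⁻ x, f x ∂weightedMeasure = ∫⁻ x, ENNReal.ofReal (1 + x ^ 2) * f x := by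
  rw [weightedMeasure, lintegral_withDensity_eq_lintegral_mul _ measurable_weight hf]
  rfl

theorem volume_le_weightedMeasure : (volume : Measure ℝ) ≤ weightedMeasure := by
  have h := withDensity_mono (μ := (volume : Measure ℝ)) (f := 1)
    (g := fun x : ℝ => ENNReal.ofReal (1 + x ^ 2)) (.of_forall fun x => by
      simp only [Pi.one_apply]
      rw [← ENNReal.ofReal_one]
      exact ENNReal.ofReal_le_ofReal (by nlinarith [sq_nonneg x]))
  rwa [withDensity_one] at h

theorem ae_weightedMeasure : ae weightedMeasure = ae (volume : Measure ℝ) :=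
  le_antisymm (withDensity_absolutelyContinuous _ _).ae_le
    (Measure.absolutelyContinuous_of_le volume_le_weightedMeasure).ae_le

theorem WeightedL1.integrable (f : WeightedL1) : Integrable f volume :=
  (L1.integrable_coeFn f).mono_measure volume_le_weightedMeasure

theorem IsKernel.convolutionExists {J : ℝ → ℝ} {d : ℝ} (hJ : IsKernel J d) {g : ℝ → ℝ}
    (hg : Integrable g) : ConvolutionExists J g (ContinuousLinearMap.lsmul ℝ ℝ) volume :=
  hJ.hasCompactSupport.convolutionExists_left _ hJ.continuous hg.locallyIntegrable

theorem IsKernel.enorm_convolution_le {J : ℝ → ℝ} {d : ℝ} (hJ : IsKernel J d) (g : ℝ → ℝ)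
    (x : ℝ) : ‖convolution J g (ContinuousLinearMap.lsmul ℝ ℝ) volume x‖ₑ
      ≤ ∫⁻ y, ENNReal.ofReal (J (x - y)) * ‖g y‖ₑ := by
  rw [convolution_eq_swap]
  refine (enorm_integral_le_lintegral_enorm _).trans_eq (lintegral_congr fun y => ?_)
  simp only [ContinuousLinearMap.lsmul_apply, smul_eq_mul, enorm_mul]
  rw [Real.enorm_eq_ofReal (hJ.nonneg _)]

/-- One step of the killed walk on real functions. -/
noncomputable def killedConv (H : Set ℝ) (J g : ℝ → ℝ) : ℝ → ℝ :=
  Hᶜ.indicator (convolution J g (ContinuousLinearMap.lsmul ℝ ℝ) volume)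

theorem killedConv_add {J : ℝ → ℝ} {d : ℝ} (hJ : IsKernel J d) (H : Set ℝ) {f g : ℝ → ℝ}
    (hf : Integrable f) (hg : Integrable g) :
    killedConv H J (f + g) = killedConv H J f + killedConv H J g := by
  unfold killedConv
  rw [(hJ.convolutionExists hf).distrib_add (hJ.convolutionExists hg), indicator_add']

theorem killedConv_smul (H : Set ℝ) (J : ℝ → ℝ) (c : ℝ) (f : ℝ → ℝ) :
    killedConv H J (c • f) = c • killedConv H J f := by
  unfold killedConv
  rw [convolution_smul]
  ext x
  by_cases h : x ∈ Hᶜ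
  · rw [Pi.smul_apply, indicator_of_mem h, indicator_of_mem h, Pi.smul_apply]
  · rw [Pi.smul_apply, indicator_of_notMem h, indicator_of_notMem h, smul_zero]

theorem killedConv_congr (H : Set ℝ) (J : ℝ → ℝ) {f g : ℝ → ℝ} (h : f =ᵐ[volume] g) :
    killedConv H J f = killedConv H J g := by
  unfold killedConv
  rw [convolution_congr _ (Filter.EventuallyEq.refl _ J) h]

/-- A jump has length below `d`, so it changes the weight by at most the factor `2 + 2d²`. -/
theorem lintegral_enorm_killedConv_le {J : ℝ → ℝ} {d : ℝ} (hJ : IsKernel J d) (H : Set ℝ)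
    {g : ℝ → ℝ} (hg : Measurable g) :
    ∫⁻ x, ENNReal.ofReal (1 + x ^ 2) * ‖killedConv H J g x‖ₑ
      ≤ ENNReal.ofReal (2 + 2 * d ^ 2) * ∫⁻ y, ENNReal.ofReal (1 + y ^ 2) * ‖g y‖ₑ := by
  have hJm := hJ.continuous.measurable
  calc ∫⁻ x, ENNReal.ofReal (1 + x ^ 2) * ‖killedConv H J g x‖ₑ
      ≤ ∫⁻ x, ∫⁻ y, ENNReal.ofReal (1 + x ^ 2) * (ENNReal.ofReal (J (x - y)) * ‖g y‖ₑ) := by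
        refine lintegral_mono fun x => ?_
        rw [lintegral_const_mul _ (by fun_prop)]
        refine mul_le_mul_right ?_ _
        refine le_trans ?_ (hJ.enorm_convolution_le g x)
        exact enorm_indicator_le_enorm_self _ _
    _ = ∫⁻ y, ∫⁻ x, ENNReal.ofReal (1 + x ^ 2) * (ENNReal.ofReal (J (x - y)) * ‖g y‖ₑ) :=
        lintegral_lintegral_swap (by fun_prop)
    _ ≤ ∫⁻ y, ∫⁻ x, (ENNReal.ofReal (2 + 2 * d ^ 2) * (ENNReal.ofReal (1 + y ^ 2) * ‖g y‖ₑ))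
          * ENNReal.ofReal (J (y - x)) := by
        refine lintegral_mono fun y => lintegral_mono fun x => ?_
        rw [← hJ.even (x - y), neg_sub]
        rcases lt_or_ge |y - x| d with h | h
        · have h1 : ENNReal.ofReal (1 + x ^ 2)
              ≤ ENNReal.ofReal (2 + 2 * d ^ 2) * ENNReal.ofReal (1 + y ^ 2) := by
            rw [← ENNReal.ofReal_mul (by positivity)]
            refine ENNReal.ofReal_le_ofReal ?_
            have h2 : (y - x) ^ 2 ≤ d ^ 2 := by rw [← sq_abs]; gcongr
            nlinarith [sq_nonneg (y - (y - x) - x), sq_nonneg (y + (y - x)),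
              mul_nonneg (sq_nonneg d) (sq_nonneg y)]
          calc ENNReal.ofReal (1 + x ^ 2) * (ENNReal.ofReal (J (y - x)) * ‖g y‖ₑ)
              ≤ (ENNReal.ofReal (2 + 2 * d ^ 2) * ENNReal.ofReal (1 + y ^ 2))
                * (ENNReal.ofReal (J (y - x)) * ‖g y‖ₑ) := mul_le_mul_left h1 _
            _ = _ := by ring
        · simp [hJ.eq_zero_of_le_abs h]
    _ = ENNReal.ofReal (2 + 2 * d ^ 2) * ∫⁻ y, ENNReal.ofReal (1 + y ^ 2) * ‖g y‖ₑ := by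
        rw [← lintegral_const_mul _ (by fun_prop)]
        refine lintegral_congr fun y => ?_
        rw [lintegral_const_mul _ (by fun_prop), hJ.lintegral_sub_left, mul_one]

theorem measurable_killedConv {J : ℝ → ℝ} {d : ℝ} (hJ : IsKernel J d) {H : Set ℝ}
    (hH : MeasurableSet H) {g : ℝ → ℝ} (hg : Integrable g) : Measurable (killedConv H J g) :=
  (hJ.hasCompactSupport.continuous_convolution_left _ hJ.continuous
    hg.locallyIntegrable).measurable.indicator hH.compl

theorem eLpNorm_killedConv_le {J : ℝ → ℝ} {d : ℝ} (hJ : IsKernel J d) {H : Set ℝ}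
    (hH : MeasurableSet H) (f : WeightedL1) :
    eLpNorm (killedConv H J f) 1 weightedMeasure
      ≤ ENNReal.ofReal (2 + 2 * d ^ 2) * eLpNorm f 1 weightedMeasure := by
  have hf : Measurable f := (Lp.stronglyMeasurable f).measurable
  rw [eLpNorm_one_eq_lintegral_enorm, eLpNorm_one_eq_lintegral_enorm,
    lintegral_weightedMeasure (measurable_killedConv hJ hH f.integrable).enorm,
    lintegral_weightedMeasure hf.enorm]
  exact lintegral_enorm_killedConv_le hJ H hf

theorem memLp_killedConv {J : ℝ → ℝ} {d : ℝ} (hJ : IsKernel J d) {H : Set ℝ}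
    (hH : MeasurableSet H) (f : WeightedL1) : MemLp (killedConv H J f) 1 weightedMeasure :=
  ⟨(measurable_killedConv hJ hH f.integrable).aestronglyMeasurable,
    (eLpNorm_killedConv_le hJ hH f).trans_lt
      (ENNReal.mul_lt_top ENNReal.ofReal_lt_top (Lp.memLp f).2)⟩

/-- One step of the killed walk as a bounded operator on `L¹(ℝ, (1 + x²) dx)`. -/
noncomputable def killedCLM {J : ℝ → ℝ} {d : ℝ} (hJ : IsKernel J d) {H : Set ℝ}
    (hH : MeasurableSet H) : WeightedL1 →L[ℝ] WeightedL1 :=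
  LinearMap.mkContinuous
    { toFun := fun f => (memLp_killedConv hJ hH f).toLp _
      map_add' := fun f g => by
        rw [← MemLp.toLp_add]
        refine MemLp.toLp_congr _ _ (.of_forall fun x => ?_)
        rw [← killedConv_add hJ H f.integrable g.integrable]
        refine congrFun (killedConv_congr H J ?_) x
        have := Lp.coeFn_add f g
        rwa [Filter.EventuallyEq, ae_weightedMeasure] at this
      map_smul' := fun c f => by
        rw [RingHom.id_apply, ← MemLp.toLp_const_smul]
        refine MemLp.toLp_congr _ _ (.of_forall fun x => ?_)
        rw [← killedConv_smul]
        refine congrFun (killedConv_congr H J ?_) x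
        have := Lp.coeFn_smul c f
        rwa [Filter.EventuallyEq, ae_weightedMeasure] at this }
    (2 + 2 * d ^ 2) (fun f => by
      simp only [LinearMap.coe_mk, AddHom.coe_mk]
      rw [Lp.norm_toLp, Lp.norm_def]
      refine (ENNReal.toReal_mono (ENNReal.mul_ne_top ENNReal.ofReal_ne_top (Lp.memLp f).2.ne)
        (eLpNorm_killedConv_le hJ hH f)).trans_eq ?_
      rw [ENNReal.toReal_mul, ENNReal.toReal_ofReal (by positivity)])

theorem killedCLM_coeFn {J : ℝ → ℝ} {d : ℝ} (hJ : IsKernel J d) {H : Set ℝ}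
    (hH : MeasurableSet H) (f : WeightedL1) :
    ∀ᵐ x, killedCLM hJ hH f x = killedConv H J f x := by
  have := (memLp_killedConv hJ hH f).coeFn_toLp
  rwa [Filter.EventuallyEq, ae_weightedMeasure] at this

/-- Transfers pointwise bounds for `killedOp` to the operator powers acting on classes. The
vanishing of `f` on `H` serves the case `n = 0`, where nothing has been killed yet. -/
theorem enorm_killedCLM_pow_le {J : ℝ → ℝ} {d : ℝ} (hJ : IsKernel J d) {H : Set ℝ}
    (hH : MeasurableSet H) {f : WeightedL1} (hf : ∀ᵐ x, x ∈ H → f x = 0) (n : ℕ) :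
    ∀ᵐ x, ‖(killedCLM hJ hH ^ n) f x‖ₑ
      ≤ Hᶜ.indicator ((killedOp H J)^[n] fun y => ‖f y‖ₑ) x := by
  induction n with
  | zero =>
    filter_upwards [hf] with x hx
    by_cases h : x ∈ H
    · simp [hx h]
    · rw [indicator_of_mem (show x ∈ Hᶜ from h)]
      exact le_rfl
  | succ n ih =>
    rw [pow_succ']
    filter_upwards [killedCLM_coeFn hJ hH ((killedCLM hJ hH ^ n) f)] with x hx
    change ‖killedCLM hJ hH ((killedCLM hJ hH ^ n) f) x‖ₑ ≤ _
    rw [hx, killedConv]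
    by_cases h : x ∈ H
    · rw [indicator_of_notMem (show x ∉ Hᶜ from fun h' => h' h)]
      simp
    rw [indicator_of_mem (show x ∈ Hᶜ from h), indicator_of_mem (show x ∈ Hᶜ from h),
      Function.iterate_succ_apply', killedOp, ← lintegral_indicator hH.compl]
    refine (hJ.enorm_convolution_le _ x).trans (lintegral_mono_ae ?_)
    filter_upwards [ih] with y hy
    rw [indicator_mul_right]
    exact mul_le_mul_right hy _

/-! ### The solution as an exponential series. -/

/-- The equation gives the derivative only off `H`. Restriction to `H` is a continuous linear map
annihilating `u s` for all `s > 0`, hence it annihilates the derivative too. -/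
theorem IsSolution.hasDerivAt {H : Set ℝ} {J u₀ : ℝ → ℝ} {d : ℝ} {u : ℝ → WeightedL1}
    (hJ : IsKernel J d) (hH : MeasurableSet H) (hu : IsSolution H J u₀ u) {t : ℝ} (ht : 0 < t) :
    HasDerivAt u (killedCLM hJ hH (u t) - u t) t := by
  obtain ⟨v, hv, hveq⟩ := hu.equation t ht
  set P := LpToLpRestrictCLM ℝ ℝ ℝ weightedMeasure 1 H
  have hP0 : ∀ s > 0, P (u s) = 0 := by
    intro s hs
    rw [Lp.eq_zero_iff_ae_eq_zero]
    have h1 := LpToLpRestrictCLM_coeFn ℝ (μ := weightedMeasure) (p := 1) H (u s)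
    have h2 : ∀ᵐ x ∂weightedMeasure, x ∈ H → u s x = 0 := by
      rw [ae_weightedMeasure]; exact hu.eq_zero s hs
    filter_upwards [h1, (ae_restrict_iff' hH).2 h2] with x hx1 hx2
    rw [hx1, hx2]; rfl
  have hPv : P v = 0 := by
    have h1 : HasDerivAt (fun s => P (u s)) (P v) t := P.hasFDerivAt.comp_hasDerivAt t hv
    have h2 : HasDerivAt (fun s => P (u s)) 0 t := by
      refine (hasDerivAt_const t (0 : Lp ℝ 1 (weightedMeasure.restrict H))).congr_of_eventuallyEq ?_
      filter_upwards [lt_mem_nhds ht] with s hs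
      exact hP0 s hs
    exact h1.unique h2
  have hvH : ∀ᵐ x, x ∈ H → v x = 0 := by
    have h1 := LpToLpRestrictCLM_coeFn ℝ (μ := weightedMeasure) (p := 1) H v
    have h2 := Lp.coeFn_zero ℝ 1 (weightedMeasure.restrict H)
    rw [← ae_weightedMeasure, ← ae_restrict_iff' hH]
    change P v =ᵐ[_] _ at h1
    rw [hPv] at h1
    filter_upwards [h1, h2] with x hx1 hx2
    rw [← hx1, hx2]; rfl
  suffices h : v = killedCLM hJ hH (u t) - u t by rwa [← h]
  refine Lp.ext ?_
  have h3 := Lp.coeFn_sub (killedCLM hJ hH (u t)) (u t)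
  rw [Filter.EventuallyEq, ae_weightedMeasure] at h3 ⊢
  filter_upwards [h3, hveq, hvH, hu.eq_zero t ht, killedCLM_coeFn hJ hH (u t)] with x e1 e2 e3 e4 e5
  rw [e1, Pi.sub_apply, e5, killedConv]
  by_cases hx : x ∈ H
  · rw [e3 hx, e4 hx, indicator_of_notMem (show x ∉ Hᶜ from fun h' => h' hx), sub_zero]
  · rw [e2 hx, indicator_of_mem (show x ∈ Hᶜ from hx), nonlocalOp]

/-- Uniqueness for a linear equation `u' = S u - u`, in the form of the exponential formula. -/
theorem exp_smul_eq_exp_clm_apply {E : Type*} [NormedAddCommGroup E] [NormedSpace ℝ E]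
    [CompleteSpace E] (S : E →L[ℝ] E) {u : ℝ → E} (hc : ContinuousOn u (Ici 0))
    (hu : ∀ t > 0, HasDerivAt u (S (u t) - u t) t) {t : ℝ} (ht : 0 < t) :
    Real.exp t • u t = NormedSpace.exp (t • S) (u 0) := by
  -- Variation of constants: `F` has zero derivative, the factor `exp s` absorbing the term `-u`,
  -- and the claim is `F t = F 0`.
  set F : ℝ → E := fun s => NormedSpace.exp ((t - s) • S) (Real.exp s • u s) with hF
  have hE : ∀ s, HasDerivAt (fun s => NormedSpace.exp ((t - s) • S))
      (-(NormedSpace.exp ((t - s) • S) * S)) s := by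
    intro s
    have h1 := hasDerivAt_exp_smul_const (𝕂 := ℝ) S (t - s)
    have h2 : HasDerivAt (fun s : ℝ => t - s) (-1) s := by
      simpa using (hasDerivAt_id s).const_sub t
    have h3 := h1.scomp s h2
    rw [neg_one_smul] at h3
    exact h3
  have hFd : ∀ s > 0, HasDerivAt F 0 s := by
    intro s hs
    have h1 := (Real.hasDerivAt_exp s).smul (hu s hs)
    have h2 := (hE s).clm_apply h1
    convert! h2 using 1
    simp [smul_sub]
  have hFc : ContinuousOn F (Icc 0 t) := by
    have h1 : Continuous fun s => NormedSpace.exp ((t - s) • S) :=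
      continuous_iff_continuousAt.2 fun s => (hE s).continuousAt
    exact h1.continuousOn.clm_apply
      (Real.continuous_exp.continuousOn.smul (hc.mono Icc_subset_Ici_self))
  -- Differentiability is known only for `s > 0`, so `F` is constant on `[ε, t]`; continuity at 0
  -- finishes.
  have hconst : ∀ ε ∈ Ioo 0 t, F ε = F t := by
    intro ε hε
    refine (constant_of_has_deriv_right_zero (hFc.mono (Icc_subset_Icc_left hε.1.le))
      (fun s hs => (hFd s (hε.1.trans_le hs.1)).hasDerivWithinAt) t ⟨hε.2.le, le_rfl⟩).symm
  have hlim : Filter.Tendsto F (nhdsWithin 0 (Ioo 0 t)) (nhds (F 0)) :=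
    (hFc 0 ⟨le_rfl, ht.le⟩).mono_left (nhdsWithin_mono _ Ioo_subset_Icc_self)
  have hlim2 : Filter.Tendsto F (nhdsWithin 0 (Ioo 0 t)) (nhds (F t)) :=
    tendsto_const_nhds.congr' (Filter.eventually_of_mem self_mem_nhdsWithin
      fun ε hε => (hconst ε hε).symm)
  have : (nhdsWithin 0 (Ioo 0 t)).NeBot := left_nhdsWithin_Ioo_neBot ht
  have h := tendsto_nhds_unique hlim2 hlim
  simpa [hF] using h

/-! ### Poisson averaging. -/

/-- Arithmetic-geometric mean inequality. With `r = (n+1)^(3/2)` and `s = t^(3/2)` it trades the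
half-integer power of `n + 1` for an integer one. -/
theorem inv_le_half_mul_sq_add_inv {r s : ℝ} (hr : 0 < r) (hs : 0 < s) :
    1 / r ≤ (s / r ^ 2 + 1 / s) / 2 := by
  have h : (s / r ^ 2 + 1 / s) / 2 - 1 / r = (s - r) ^ 2 / (2 * s * r ^ 2) := by
    field_simp
    ring
  have : 0 ≤ (s - r) ^ 2 / (2 * s * r ^ 2) := by positivity
  linarith

theorem sqrt_pow_three_sq {x : ℝ} (hx : 0 ≤ x) : (√x ^ 3) ^ 2 = x ^ 3 := by
  rw [← pow_mul, mul_comm, pow_mul, Real.sq_sqrt hx]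

/-- Poisson average of `n ^ (-3/2)`. -/
theorem sum_pow_div_factorial_mul_le {t : ℝ} (ht : 0 < t) (N : ℕ) :
    ∑ n ∈ Finset.range N, t ^ (n + 1) / (n + 1).factorial * (1 / √((n : ℝ) + 1) ^ 3)
      ≤ 25 / 2 * Real.exp t / √t ^ 3 := by
  set s := √t ^ 3 with hs
  have hs0 : 0 < s := by positivity
  have hs2 : s ^ 2 = t ^ 3 := sqrt_pow_three_sq ht.le
  -- Bounding `(n+1)⁻³` by `24 / ((n+2)(n+3)(n+4))` turns `(n+1)!` into `(n+4)!`. As `s² = t³`, both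
  -- terms become terms of the exponential series over `s`; the constants add to `12 + 1/2 = 25/2`.
  have hterm : ∀ n : ℕ, t ^ (n + 1) / (n + 1).factorial * (1 / √((n : ℝ) + 1) ^ 3)
      ≤ 12 / s * (t ^ (4 + n) / (4 + n).factorial)
        + 1 / (2 * s) * (t ^ (1 + n) / (1 + n).factorial) := by
    intro n
    set r := √((n : ℝ) + 1) ^ 3 with hr
    have hr0 : 0 < r := by positivity
    have hr2 : r ^ 2 = ((n : ℝ) + 1) ^ 3 := sqrt_pow_three_sq (by positivity)
    have hfac : ((4 + n).factorial : ℝ) = (n + 4) * (n + 3) * (n + 2) * (n + 1).factorial := by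
      rw [show 4 + n = n + 1 + 1 + 1 + 1 by ring, Nat.factorial_succ (n + 1 + 1 + 1),
        Nat.factorial_succ (n + 1 + 1), Nat.factorial_succ (n + 1)]
      push_cast
      ring
    have hf0 : (0 : ℝ) < (n + 1).factorial := by positivity
    have h1 : 1 / ((n : ℝ) + 1) ^ 3 ≤ 24 / ((n + 4) * (n + 3) * (n + 2)) := by
      have hn : (0 : ℝ) ≤ n := Nat.cast_nonneg n
      rw [div_le_div_iff₀ (by positivity) (by positivity)]
      have : ((n : ℝ) + 4) * (n + 3) * (n + 2) ≤ (4 * (n + 1)) * (3 * (n + 1)) * (2 * (n + 1)) := by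
        gcongr <;> linarith
      nlinarith
    calc t ^ (n + 1) / (n + 1).factorial * (1 / r)
        ≤ t ^ (n + 1) / (n + 1).factorial * ((s / r ^ 2 + 1 / s) / 2) := by
          exact mul_le_mul_of_nonneg_left (inv_le_half_mul_sq_add_inv hr0 hs0) (by positivity)
      _ = t ^ (n + 1) / (n + 1).factorial * (s / 2 * (1 / ((n : ℝ) + 1) ^ 3) + 1 / (2 * s)) := by
          rw [hr2]; ring
      _ ≤ t ^ (n + 1) / (n + 1).factorial
            * (s / 2 * (24 / ((n + 4) * (n + 3) * (n + 2))) + 1 / (2 * s)) := by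
          gcongr
      _ = _ := by
          have e : s * s = t ^ 3 := by rw [← hs2]; ring
          have e' : s = t ^ 3 / s := by rw [← e]; field_simp
          rw [hfac, show 1 + n = n + 1 by ring, show t ^ (4 + n) = t ^ 3 * t ^ (n + 1) by ring]
          conv_lhs => rw [show s / 2 = t ^ 3 / s / 2 by rw [← e']]
          field_simp
          ring
  have hexp : ∀ k : ℕ, ∑ n ∈ Finset.range N, t ^ (k + n) / (k + n).factorial ≤ Real.exp t := by
    intro k
    have h1 := Finset.sum_range_add (fun n => t ^ n / (n.factorial : ℝ)) k N
    have h2 : 0 ≤ ∑ n ∈ Finset.range k, t ^ n / (n.factorial : ℝ) :=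
      Finset.sum_nonneg fun n _ => by positivity
    have h3 := Real.sum_le_exp_of_nonneg ht.le (k + N)
    linarith
  refine (Finset.sum_le_sum fun n _ => hterm n).trans ?_
  rw [Finset.sum_add_distrib, ← Finset.mul_sum, ← Finset.mul_sum]
  calc _ ≤ 12 / s * Real.exp t + 1 / (2 * s) * Real.exp t := by
        gcongr
        · exact hexp 4
        · exact hexp 1
    _ = 25 / 2 * Real.exp t / s := by field_simp; ring

theorem exp_neg_le_div_sqrt_pow {t : ℝ} (ht : 1 < t) : Real.exp (-t) ≤ 2 / √t ^ 3 := by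
  have h1 : t ^ 2 / 2 ≤ Real.exp t := by
    have := Real.quadratic_le_exp_of_nonneg (x := t) (by linarith)
    linarith
  have h2 : √t ^ 3 ≤ t ^ 2 := by
    have h3 : 1 ≤ √t := Real.one_le_sqrt.2 ht.le
    calc √t ^ 3 ≤ √t ^ 4 := pow_le_pow_right₀ h3 (by norm_num)
      _ = (√t ^ 2) ^ 2 := by ring
      _ = t ^ 2 := by rw [Real.sq_sqrt (by linarith)]
  rw [Real.exp_neg, ← one_div, div_le_div_iff₀ (Real.exp_pos t) (by positivity)]
  linarith

/-! ### From the series to the pointwise bound. -/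

theorem lintegral_enorm_mul_abs_add_lt_top (f : WeightedL1) (H : Set ℝ) {b : ℝ} (hb : 0 ≤ b) :
    ∫⁻ x in Hᶜ, ‖f x‖ₑ * ENNReal.ofReal (|x| + b) < ∞ := by
  have hf : Measurable f := (Lp.stronglyMeasurable f).measurable
  have h : ∫⁻ x, ENNReal.ofReal (1 + x ^ 2) * ‖f x‖ₑ < ∞ := by
    rw [← lintegral_weightedMeasure hf.enorm, ← eLpNorm_one_eq_lintegral_enorm]
    exact (Lp.memLp f).2
  refine lt_of_le_of_lt ?_ (ENNReal.mul_lt_top (ENNReal.ofReal_lt_top (r := 1 + b)) h)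
  rw [← lintegral_const_mul _ (by fun_prop)]
  refine (lintegral_mono' Measure.restrict_le_self le_rfl).trans (lintegral_mono fun x => ?_)
  rw [← mul_assoc, ← ENNReal.ofReal_mul (by positivity), mul_comm]
  refine mul_le_mul_left (ENNReal.ofReal_le_ofReal ?_) _
  have h1 : |x| ≤ 1 + x ^ 2 := by nlinarith [sq_nonneg (|x| - 1), sq_abs x, abs_nonneg x]
  nlinarith [mul_nonneg hb (sq_nonneg x)]

/-- An almost everywhere bound for the sum of a convergent series in `L¹(ℝ, (1 + x²) dx)`. -/
theorem ae_abs_le_of_hasSum {f : ℕ → WeightedL1} {g : WeightedL1} (h : HasSum f g)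
    {s : Set ℝ} {B : ℝ → ℝ}
    (hB : ∀ᵐ x, x ∈ s → ∀ N, ∑ n ∈ Finset.range N, |f n x| ≤ B x) :
    ∀ᵐ x, x ∈ s → |g x| ≤ B x := by
  -- Norm convergence gives almost everywhere convergence along a subsequence of partial sums,
  -- enough because the bound is uniform in `N`.
  have h1 := tendstoInMeasure_of_tendsto_Lp h.tendsto_sum_nat
  obtain ⟨ns, -, hns⟩ := h1.exists_seq_tendsto_ae
  have h2 : ∀ᵐ x, ∀ N, (∑ n ∈ Finset.range N, f n : WeightedL1) x = ∑ n ∈ Finset.range N, f n x := by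
    rw [← ae_weightedMeasure, ae_all_iff]
    exact fun N => Lp.coeFn_fun_finsetSum _ _
  rw [ae_weightedMeasure] at hns
  filter_upwards [hns, h2, hB] with x hx1 hx2 hx3 hxs
  refine le_of_tendsto hx1.abs (.of_forall fun i => ?_)
  rw [hx2]
  exact (Finset.abs_sum_le_sum_abs _ _).trans (hx3 hxs _)

theorem IsSolution.hasSum {H : Set ℝ} {J u₀ : ℝ → ℝ} {d : ℝ} {u : ℝ → WeightedL1}
    (hJ : IsKernel J d) (hH : MeasurableSet H) (hu : IsSolution H J u₀ u) {t : ℝ} (ht : 0 < t) :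
    HasSum (fun n : ℕ => (t ^ n / n.factorial : ℝ) • (killedCLM hJ hH ^ n) (u 0))
      (Real.exp t • u t) := by
  rw [exp_smul_eq_exp_clm_apply (killedCLM hJ hH) hu.continuousOn
    (fun t ht => hu.hasDerivAt hJ hH ht) ht]
  have h := (NormedSpace.exp_series_hasSum_exp' (𝕂 := ℝ) (t • killedCLM hJ hH)).mapL
    (ContinuousLinearMap.apply ℝ WeightedL1 (u 0))
  convert! h using 2 with n
  simp [smul_pow, smul_smul, div_eq_inv_mul]

/-- The decay `O((|x| + b) t ^ (-3/2))` of solutions, uniformly on the complement of the hole. -/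
theorem IsSolution.exists_abs_le {H : Set ℝ} {a₀ a d : ℝ} {J u₀ : ℝ → ℝ} {u : ℝ → WeightedL1}
    (hH : IsHole H a₀ a) (hJ : IsKernel J d) (hu₀ : IsInitialDatum H u₀)
    (hu : IsSolution H J u₀ u) :
    ∃ b > 0, ∃ C > 0, ∀ t > 1, ∀ᵐ x, x ∉ H → |u t x| ≤ C * ((|x| + b) / √t ^ 3) := by
  have hHm : MeasurableSet H := hH.isOpen.measurableSet
  have ha₀ := hH.a₀_pos
  -- The least `b` allowed by the superharmonicity condition.
  set b := 2 * (d ^ 2 + a₀ ^ 2) / a₀ with hb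
  have hb0 : 0 < b := by positivity
  have hsup : ∀ x, killedOp H J (fun y => ENNReal.ofReal (|y| + b)) x ≤ ENNReal.ofReal (|x| + b) :=
    hJ.killedOp_abs_le ha₀ hH.inner_subset hb0.le (by rw [hb]; field_simp; rfl)
  obtain ⟨C, hC, hdecay⟩ := hJ.killedOp_iterate_le hb0 hsup
  set S := killedCLM hJ hHm
  have hum : Measurable (u 0) := (Lp.stronglyMeasurable (u 0)).measurable
  set Φ := ∫⁻ x in Hᶜ, ‖u 0 x‖ₑ * ENNReal.ofReal (|x| + b) with hΦ
  have hΦt : Φ < ∞ := lintegral_enorm_mul_abs_add_lt_top (u 0) H hb0.le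
  have hu0H : ∀ᵐ x, x ∈ H → u 0 x = 0 := by
    filter_upwards [hu.initial, hu₀.eq_zero] with x h1 h2 h3
    rw [h1, h2 h3]
  obtain ⟨M, hM0, hM⟩ : ∃ M > 0, ∀ᵐ x, |u 0 x| ≤ M := by
    refine ⟨(eLpNorm u₀ ⊤ volume).toReal + 1, by positivity, ?_⟩
    have hfin := hu₀.memLp_top.2
    rw [eLpNorm_exponent_top] at hfin ⊢
    filter_upwards [hu.initial, ae_le_eLpNormEssSup (f := u₀) (μ := volume)] with x h1 h2
    rw [h1]
    have h3 := ENNReal.toReal_mono hfin.ne h2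
    rw [toReal_enorm, Real.norm_eq_abs] at h3
    linarith
  set A := C * Φ.toReal with hA
  have hA0 : 0 ≤ A := by positivity
  have hpow : ∀ᵐ x, x ∉ H → ∀ n : ℕ,
      |(S ^ (n + 1)) (u 0) x| ≤ A * (|x| + b) * (1 / √((n : ℝ) + 1) ^ 3) := by
    have h1 : ∀ᵐ x, ∀ n, ‖(S ^ n) (u 0) x‖ₑ
        ≤ Hᶜ.indicator ((killedOp H J)^[n] fun y => ‖u 0 y‖ₑ) x :=
      ae_all_iff.2 fun n => enorm_killedCLM_pow_le hJ hHm hu0H n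
    filter_upwards [h1] with x hx hxH n
    have h2 := hx (n + 1)
    rw [indicator_of_mem (show x ∈ Hᶜ from hxH)] at h2
    have h3 := h2.trans (hdecay _ hum.enorm n x)
    rw [← hΦ, ← ENNReal.ofReal_toReal hΦt.ne, ← ENNReal.ofReal_mul (by positivity),
      Real.enorm_eq_ofReal_abs, ENNReal.ofReal_le_ofReal_iff (by positivity)] at h3
    refine h3.trans_eq ?_
    rw [hA]; ring
  -- The part `2M/b` pays for the term `n = 0`, the only one using boundedness of `u₀`: there `e⁻ᵗ M
  -- ≤ 2M / t^(3/2)` and `1 ≤ (|x| + b) / b`.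
  refine ⟨b, hb0, 2 * M / b + 25 / 2 * A, by positivity, fun t ht => ?_⟩
  have ht0 : 0 < t := by linarith
  set s := √t ^ 3 with hs
  have hs0 : 0 < s := by positivity
  have hpart : ∀ᵐ x, x ∈ Hᶜ → ∀ N, ∑ n ∈ Finset.range N,
      |((t ^ n / n.factorial : ℝ) • (S ^ n) (u 0) : WeightedL1) x|
        ≤ M + A * (|x| + b) * (25 / 2 * Real.exp t / s) := by
    have h1 : ∀ᵐ x, ∀ n : ℕ, ((t ^ n / n.factorial : ℝ) • (S ^ n) (u 0) : WeightedL1) x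
        = (t ^ n / n.factorial : ℝ) * (S ^ n) (u 0) x := by
      rw [← ae_weightedMeasure, ae_all_iff]
      exact fun n => Lp.coeFn_smul _ _
    filter_upwards [h1, hpow, hM] with x hx1 hx2 hx3 hxH N
    have hN : N ≤ N + 1 := N.le_succ
    refine (Finset.sum_le_sum_of_subset_of_nonneg (Finset.range_mono hN)
      fun i _ _ => abs_nonneg _).trans ?_
    rw [Finset.sum_range_succ', add_comm]
    refine add_le_add ?_ ?_
    · rw [hx1]; simpa using hx3
    · refine le_trans ?_ (mul_le_mul_of_nonneg_left (sum_pow_div_factorial_mul_le ht0 N)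
        (by positivity : 0 ≤ A * (|x| + b)))
      rw [Finset.mul_sum]
      refine Finset.sum_le_sum fun n _ => ?_
      have hc : 0 ≤ t ^ (n + 1) / ((n + 1).factorial : ℝ) := by positivity
      rw [hx1, abs_mul, abs_of_nonneg hc]
      refine (mul_le_mul_of_nonneg_left (hx2 hxH n) hc).trans_eq ?_
      ring
  have hsum := ae_abs_le_of_hasSum (hu.hasSum hJ hHm ht0) hpart
  have hsmul : ∀ᵐ x, (Real.exp t • u t : WeightedL1) x = Real.exp t * u t x := by
    rw [← ae_weightedMeasure]
    exact Lp.coeFn_smul _ _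
  filter_upwards [hsum, hsmul] with x h1 h2 hxH
  have h3 := h1 hxH
  rw [h2, abs_mul, abs_of_pos (Real.exp_pos t)] at h3
  have h4 : |u t x| ≤ Real.exp (-t) * (M + A * (|x| + b) * (25 / 2 * Real.exp t / s)) := by
    rw [Real.exp_neg, ← div_eq_inv_mul, le_div_iff₀ (Real.exp_pos t)]
    linarith
  have h5 : Real.exp (-t) * (M + A * (|x| + b) * (25 / 2 * Real.exp t / s))
      = Real.exp (-t) * M + 25 / 2 * A * ((|x| + b) / s) := by
    rw [Real.exp_neg]; field_simp
  have h6 : Real.exp (-t) * M ≤ 2 * M / b * ((|x| + b) / s) := by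
    calc Real.exp (-t) * M ≤ 2 / s * M := by gcongr; exact exp_neg_le_div_sqrt_pow ht
      _ = 2 * M / b * ((0 + b) / s) := by field_simp; ring
      _ ≤ 2 * M / b * ((|x| + b) / s) := by gcongr; exact abs_nonneg x
  linarith

theorem proposition5p3 (H : Set ℝ) (a₀ a d : ℝ) (J u₀ : ℝ → ℝ) (u : ℝ → WeightedL1)
    (hH : IsHole H a₀ a) (hJ : IsKernel J d) (hu₀ : IsInitialDatum H u₀)
    (hu : IsSolution H J u₀ u) :
    ∃ b > 0, ∃ α > 0, ∃ T > 0, ∃ C > 0, ∀ t > T, ∀ᵐ x,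
      x ∉ H → (|x| + b) ^ 2 ≤ 4 * α * t →
        u t x ≤ C * ((|x| + b) / t ^ (3 / 2 : ℝ)) * Real.exp (-(|x| + b) ^ 2 / (4 * α * t)) := by
  -- The value `α = 1` is arbitrary; the factor `exp 1` compensates a Gaussian that is at least
  -- `e⁻¹` in the region considered.
  obtain ⟨b, hb, C, hC, h⟩ := hu.exists_abs_le hH hJ hu₀
  refine ⟨b, hb, 1, one_pos, 1, one_pos, C * Real.exp 1, by positivity, fun t ht => ?_⟩
  have ht0 : 0 < t := by linarith
  have hpow : t ^ (3 / 2 : ℝ) = √t ^ 3 := by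
    rw [Real.sqrt_eq_rpow, ← Real.rpow_natCast, ← Real.rpow_mul ht0.le]
    norm_num
  filter_upwards [h t ht] with x hx hxH hxt
  rw [hpow]
  have h1 : Real.exp (-1) ≤ Real.exp (-(|x| + b) ^ 2 / (4 * 1 * t)) := by
    refine Real.exp_le_exp.2 ?_
    rw [le_div_iff₀ (by positivity)]
    linarith
  calc u t x ≤ C * ((|x| + b) / √t ^ 3) := (le_abs_self _).trans (hx hxH)
    _ = C * Real.exp 1 * ((|x| + b) / √t ^ 3) * Real.exp (-1) := by
        rw [Real.exp_neg]; field_simp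
    _ ≤ _ := by gcongr
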